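/- Let $\mathcal S=(X,T,X_0,\to,\Sigma,\ell)$ be a finite automaton: $X$ (states), $T$ (events) and $\Sigma$ (outputs) are finite sets, $X_0\subseteq X$, $\to\;\subseteq X\times T\times X$, and $\ell:T\to\Sigma\cup\{\epsilon\}$ is extended to finite and infinite event sequences by concatenation. No further assumption is made; in particular, deadlocks and cycles of unobservable events are allowed. For $w\in\Sigma^*$ let $\mathcal M(\mathcal S,w)$ be the set of states that can be reached from a state of $X_0$ by a (possibly empty) event sequence with label sequence $w$, and let $\mathcal L^\omega(\mathcal S)\subseteq\Sigma^\omega$ be the set of the infinite label sequences of infinite event sequences that can be run from a state of $X_0$. $\mathcal S$ is strongly detectable if there is a positive integer $k$ such that $|\mathcal M(\mathcal S,\sigma')|=1$ for every prefix $\sigma'$ with $|\sigma'|>k$ of every $\sigma\in\mathcal L^\omega(\mathcal S)$. The accessible part $\mathrm{Acc}(\mathcal A)$ of an automaton $\mathcal A$ arises by removing all states that are not reachable from an initial state. The concurrent composition $\mathrm{CC}(\mathcal A)$ of an automaton $\mathcal A$ with state set $Z$, initial states $Z_0$ and events $T$ has state set $Z\times Z$ and initial states $Z_0\times Z_0$.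 Its events are the pairs $(t,t')$ with $\ell(t)=\ell(t')\neq\epsilon$, which have label $\ell(t)$ and move both components, by $t$ and $t'$ respectively, and the pairs $(t,\epsilon)$ and $(\epsilon,t)$ with $\ell(t)=\epsilon$, which have label $\epsilon$ and move only the left, respectively only the right, component, by $t$. The observation automaton of $\mathcal A$ has the states of $\mathcal A$ and one transition from $x$ to $y$ whenever $\mathcal A$ has a transition from $x$ to $y$; it is observable if one of these transitions of $\mathcal A$ has a nonempty label, and unobservable otherwise. Put $\mathcal C=\mathrm{Acc}(\mathrm{CC}(\mathrm{Acc}(\mathcal S)))$. (1) The following are equivalent. (a) $\mathcal S$ is not strongly detectable. (b) In $\mathcal C$ there are event sequences $x_0'\xrightarrow{s_1}x_1'\xrightarrow{s_2}x_1'\xrightarrow{s_3}x_2'$ such that $x_0'$ is initial, $s_2$ has a nonempty label sequence, and $x_2'=(x,\bar x)$ with $x\neq\bar x$; and in $\mathcal S$ a cycle with nonempty label sequence is reachable from $x$ (in zero or more steps). (c) Let $X_e'$ be the set of those states $(x,\bar x)$ of $\mathcal C$ with $x\ne\bar x$ that are reachable in $\mathcal C$ (in zero or more steps) from a state whose strongly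 connected component in the observation automaton of $\mathcal C$ contains an observable transition, and let $\mathcal S'$ be $\mathrm{Acc}(\mathcal S)$ with the set of initial states replaced by the set of all components of pairs in $X_e'$. Then $\mathcal L^\omega(\mathrm{Acc}(\mathcal S'))\neq\emptyset$. (d) With $\mathcal S'$ as in (c), some strongly connected component of the observation automaton of $\mathrm{Acc}(\mathcal S')$ contains an observable transition. (2) Strong detectability of finite automata can be verified in polynomial time, namely in time $O(|X|^4|T|^2)$: there are a program for a random access machine and a constant $c$ such that, for every finite automaton $\mathcal S$, given by $|X|$, $|T|$, $|\Sigma|$, the table of $\ell$ and the characteristic vectors of $X_0$ and $\to$ (with respect to any numberings of $X$, $T$, $\Sigma$), the program halts after at most $c\,(|X|^4|T|^2+1)$ elementary operations and decides correctly whether $\mathcal S$ is strongly detectable. An elementary operation is an access to a constant, a register or an array cell, an addition, truncated subtraction, multiplication or comparison, an assignment, or a branch; all numbers and addresses that occur are less than $(|X|+|T|+|\Sigma|+2)^c$, that is, they are machine words of $O(\log(|X|+|T|+|\Sigma|+2))$ bits. -/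

import Mathlib

/-! ## Labeled state-transition systems -/

/-- A labeled state-transition system with state set `X`, event set `T` and output set `Y`.
The label `none` is the empty word, so events labeled `none` are unobservable. It is a finite
automaton when `X`, `T` and `Y` are finite. -/
structure LSTS (X T Y : Type*) where
  /-- the initial states -/
  init : Set X
  /-- the transition relation -/
  trans : X → T → X → Prop
  /-- the labeling function -/
  label : T → Option Y

namespace LSTS

/-- `S.Steps x s y`: the finite, possibly empty, event sequence `s` leads from `x` to `y`. -/
inductive Steps {X T Y : Type*} (S : LSTS X T Y) : X → List T → X → Prop
  | nil (x : X) : Steps S x [] x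
  | cons {x y z : X} {t : T} {s : List T} :
      S.trans x t y → Steps S y s z → Steps S x (t :: s) z

/-- The label sequence of a finite event sequence. -/
def word {X T Y : Type*} (S : LSTS X T Y) (s : List T) : List Y :=
  s.filterMap S.label

/-- The possible current states after the output sequence `w` has been observed. (The empty event
sequence contributes exactly the initial states, and it does so only for the empty `w`.) -/
def possibleStates {X T Y : Type*} (S : LSTS X T Y) (w : List Y) : Set X :=
  {x | ∃ x₀ ∈ S.init, ∃ s : List T, S.word s = w ∧ S.Steps x₀ s x}

/-- The prefix of length `m` of an infinite sequence. -/
def takePrefix {A : Type*} (a : ℕ → A) (m : ℕ) : List A :=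
  (List.range m).map a

/-- The infinite event sequence `τ` can be run from some initial state. -/
def GeneratesEvents {X T Y : Type*} (S : LSTS X T Y) (τ : ℕ → T) : Prop :=
  ∃ x : ℕ → X, x 0 ∈ S.init ∧ ∀ i, S.trans (x i) (τ i) (x (i + 1))

/-- The label sequence of the infinite event sequence `τ` is infinite and equal to `σ`: every
finite prefix of `σ` is the label sequence of a finite prefix of `τ`. -/
def HasLabel {X T Y : Type*} (S : LSTS X T Y) (τ : ℕ → T) (σ : ℕ → Y) : Prop :=
  ∀ m, ∃ n, S.word (takePrefix τ n) = takePrefix σ m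

/-- The generated `ω`-language. -/
def omegaLanguage {X T Y : Type*} (S : LSTS X T Y) : Set (ℕ → Y) :=
  {σ | ∃ τ : ℕ → T, S.GeneratesEvents τ ∧ S.HasLabel τ σ}

/-- Strong detectability: for some positive `k`, every prefix of length greater than `k` of every
generated infinite label sequence determines the current state. -/
def StronglyDetectable {X T Y : Type*} (S : LSTS X T Y) : Prop :=
  ∃ k : ℕ, 0 < k ∧ ∀ σ ∈ S.omegaLanguage, ∀ m, k < m →
    (S.possibleStates (takePrefix σ m)).encard = 1

/-- Reachable states (the initial states are reachable). -/
def Reachable {X T Y : Type*} (S : LSTS X T Y) (x : X) : Prop :=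
  ∃ x₀ ∈ S.init, ∃ s : List T, S.Steps x₀ s x

/-- The accessible part: all non-reachable states are removed. -/
def acc {X T Y : Type*} (S : LSTS X T Y) : LSTS {x : X // S.Reachable x} T Y where
  init := {x | x.1 ∈ S.init}
  trans x t y := S.trans x.1 t y.1
  label := S.label

/-- The events of the concurrent composition: pairs of observable events with the same label,
and unobservable events paired with the empty word on one side. -/
inductive CCEvent {X T Y : Type*} (S : LSTS X T Y) : Type _
  /-- the event `(t, t')` -/
  | both (t t' : T) (h : S.label t = S.label t') (ho : S.label t ≠ none) : CCEvent S
  /-- the event `(t, ε)` -/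
  | left (t : T) (h : S.label t = none) : CCEvent S
  /-- the event `(ε, t)` -/
  | right (t : T) (h : S.label t = none) : CCEvent S

/-- The concurrent composition of `S` with itself. -/
def cc {X T Y : Type*} (S : LSTS X T Y) : LSTS (X × X) S.CCEvent Y where
  init := S.init ×ˢ S.init
  trans p e q := match e with
    | .both t t' _ _ => S.trans p.1 t q.1 ∧ S.trans p.2 t' q.2
    | .left t _ => S.trans p.1 t q.1 ∧ p.2 = q.2
    | .right t _ => p.1 = q.1 ∧ S.trans p.2 t q.2
  label e := match e with
    | .both t _ _ _ => S.label t
    | .left _ _ => none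
    | .right _ _ => none

/-- The observation automaton: all transitions from `x` to `y` are merged into a single one,
which is observable (event `true`) if one of them is, and unobservable (event `false`) otherwise. -/
def obsAut {X T Y : Type*} (S : LSTS X T Y) : LSTS X Bool Unit where
  init := S.init
  trans x b y := match b with
    | true => ∃ t, S.trans x t y ∧ S.label t ≠ none
    | false => (∃ t, S.trans x t y) ∧ ∀ t, S.trans x t y → S.label t = none
  label b := if b then some () else none

/-- `y` can be reached from `x` in zero or more steps. -/
def CanReach {X T Y : Type*} (S : LSTS X T Y) (x y : X) : Prop :=
  ∃ s : List T, S.Steps x s y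

/-- `x` and `y` lie in the same strongly connected component. -/
def SameSCC {X T Y : Type*} (S : LSTS X T Y) (x y : X) : Prop :=
  S.CanReach x y ∧ S.CanReach y x

/-- The strongly connected component of `x` contains an observable transition. -/
def HasObsSCC {X T Y : Type*} (S : LSTS X T Y) (x : X) : Prop :=
  ∃ y z : X, ∃ t : T, S.SameSCC x y ∧ S.SameSCC x z ∧ S.trans y t z ∧ S.label t ≠ none

/-- A cycle with nonempty label sequence can be reached from `x`. -/
def ReachesObsCycle {X T Y : Type*} (S : LSTS X T Y) (x : X) : Prop :=
  ∃ (y : X) (s u : List T), S.Steps x s y ∧ S.Steps y u y ∧ S.word u ≠ []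

/-- The cycle criterion: in the accessible part of the concurrent composition of the accessible
part of `S`, a cycle with nonempty label sequence leads from an initial state to a state with
different components, and from the left component of the latter a cycle with nonempty label
sequence can be reached in `S`. -/
def CycleCriterion {X T Y : Type*} (S : LSTS X T Y) : Prop :=
  ∃ x₀ ∈ S.acc.cc.acc.init, ∃ x₁ x₂, ∃ s₁ s₂ s₃,
    S.acc.cc.acc.Steps x₀ s₁ x₁ ∧ S.acc.cc.acc.Steps x₁ s₂ x₁ ∧ S.acc.cc.acc.Steps x₁ s₃ x₂ ∧
    S.acc.cc.acc.word s₂ ≠ [] ∧ x₂.1.1 ≠ x₂.1.2 ∧ S.ReachesObsCycle x₂.1.1.1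

/-- The states with different components, of the accessible part of the concurrent composition of
the accessible part of `S`, that can be reached from a strongly connected component (of its
observation automaton) that contains an observable transition. -/
def bifurcated {X T Y : Type*} (S : LSTS X T Y) : Set {p // S.acc.cc.Reachable p} :=
  {p | p.1.1 ≠ p.1.2 ∧ ∃ q, S.acc.cc.acc.obsAut.HasObsSCC q ∧ S.acc.cc.acc.CanReach q p}

/-- The accessible part of `S`, restarted from the components of the states in `bifurcated`. -/
def restarted {X T Y : Type*} (S : LSTS X T Y) : LSTS {x : X // S.Reachable x} T Y where
  init := {x | ∃ p ∈ S.bifurcated, p.1.1 = x ∨ p.1.2 = x}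
  trans := S.acc.trans
  label := S.acc.label

open Classical in
/-- The input word sequence that presents a finite automaton to a machine, relative to numberings
of its states, events and outputs: the numbers of states, events and outputs; for each event, `0`
if it is unobservable and one plus the number of its label otherwise; the characteristic vector of
the set of initial states; and the characteristic vector of the transition relation, where the
triple `(x, t, y)` has position `|X| * (|T| * x + t) + y`. -/
noncomputable def encode {X T Y : Type*} [Fintype X] [Fintype T] [Fintype Y] (S : LSTS X T Y)
    (eX : X ≃ Fin (Fintype.card X)) (eT : T ≃ Fin (Fintype.card T))
    (eY : Y ≃ Fin (Fintype.card Y)) : List ℕ :=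
  [Fintype.card X, Fintype.card T, Fintype.card Y] ++
  (List.ofFn fun t => match S.label (eT.symm t) with
    | none => 0
    | some y => (eY y : ℕ) + 1) ++
  (List.ofFn fun x => if eX.symm x ∈ S.init then 1 else 0) ++
  (List.ofFn fun i : Fin (Fintype.card X * Fintype.card T * Fintype.card X) =>
    let p := finProdFinEquiv.symm i
    let q := finProdFinEquiv.symm p.1
    if S.trans (eX.symm q.1) (eT.symm q.2) (eX.symm p.2) then 1 else 0)

end LSTS

/-! ## Word random access machines -/

namespace RAM

/-- A machine state: the contents of the registers, and the contents of the cells of the arrays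
(a program refers to finitely many registers and arrays only, the cell addresses are computed). -/
structure Store where
  /-- the registers -/
  reg : ℕ → ℕ
  /-- `arr a i` is cell number `i` of array number `a` -/
  arr : ℕ → ℕ → ℕ

/-- Write a register. -/
def Store.setReg (s : Store) (r v : ℕ) : Store :=
  { s with reg := Function.update s.reg r v }

/-- Write a cell of an array. -/
def Store.setArr (s : Store) (a i v : ℕ) : Store :=
  { s with arr := Function.update s.arr a (Function.update (s.arr a) i v) }

/-- The initial state: the input is in array `0`, everything else is `0`. -/
def Store.ofInput (input : List ℕ) : Store where
  reg _ := 0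
  arr a i := if a = 0 then input.getD i 0 else 0

/-- Arithmetic expressions. -/
inductive Expr where
  /-- a constant -/
  | lit (c : ℕ)
  /-- a register -/
  | reg (r : ℕ)
  /-- the cell of array `a` with the address given by `i` -/
  | cell (a : ℕ) (i : Expr)
  /-- addition -/
  | plus (e f : Expr)
  /-- truncated subtraction -/
  | minus (e f : Expr)
  /-- multiplication -/
  | times (e f : Expr)
  /-- `1` if `e` is less than `f`, and `0` otherwise -/
  | less (e f : Expr)
  /-- `1` if `e` equals `f`, and `0` otherwise -/
  | equal (e f : Expr)

namespace Expr

/-- The value of an expression. -/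
def eval (s : Store) : Expr → ℕ
  | lit c => c
  | reg r => s.reg r
  | cell a i => s.arr a (i.eval s)
  | plus e f => e.eval s + f.eval s
  | minus e f => e.eval s - f.eval s
  | times e f => e.eval s * f.eval s
  | less e f => if e.eval s < f.eval s then 1 else 0
  | equal e f => if e.eval s = f.eval s then 1 else 0

/-- The number of elementary operations needed to evaluate an expression. -/
def cost : Expr → ℕ
  | lit _ => 1
  | reg _ => 1
  | cell _ i => i.cost + 1
  | plus e f => e.cost + f.cost + 1
  | minus e f => e.cost + f.cost + 1
  | times e f => e.cost + f.cost + 1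
  | less e f => e.cost + f.cost + 1
  | equal e f => e.cost + f.cost + 1

/-- All values that occur in the evaluation, addresses included, are machine words, that is,
less than `W`. -/
def Fits (W : ℕ) (s : Store) : Expr → Prop
  | lit c => c < W
  | reg r => s.reg r < W
  | cell a i => i.Fits W s ∧ s.arr a (i.eval s) < W
  | plus e f => e.Fits W s ∧ f.Fits W s ∧ e.eval s + f.eval s < W
  | minus e f => e.Fits W s ∧ f.Fits W s
  | times e f => e.Fits W s ∧ f.Fits W s ∧ e.eval s * f.eval s < W
  | less e f => e.Fits W s ∧ f.Fits W s ∧ 1 < W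
  | equal e f => e.Fits W s ∧ f.Fits W s ∧ 1 < W

end Expr

/-- Programs. -/
inductive Program where
  /-- do nothing -/
  | skip
  /-- write the value of `e` into register `r` -/
  | assign (r : ℕ) (e : Expr)
  /-- write the value of `e` into the cell of array `a` with the address given by `i` -/
  | store (a : ℕ) (i e : Expr)
  /-- sequential composition -/
  | seq (p q : Program)
  /-- execute `p` if the value of `e` is nonzero, and `q` otherwise -/
  | cond (e : Expr) (p q : Program)
  /-- repeat `p` as long as the value of `e` is nonzero -/
  | loop (e : Expr) (p : Program)

/-- `Exec W p s n s'`: on a machine with words less than `W`, the program `p`, started in `s`,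
halts in `s'` after `n` elementary operations, and no value exceeds the word size on the way. -/
inductive Exec (W : ℕ) : Program → Store → ℕ → Store → Prop
  | skip (s : Store) : Exec W .skip s 1 s
  | assign {r : ℕ} {e : Expr} {s : Store} : e.Fits W s →
      Exec W (.assign r e) s (e.cost + 1) (s.setReg r (e.eval s))
  | store {a : ℕ} {i e : Expr} {s : Store} : i.Fits W s → e.Fits W s →
      Exec W (.store a i e) s (i.cost + e.cost + 1) (s.setArr a (i.eval s) (e.eval s))
  | seq {p q : Program} {s s' s'' : Store} {m n : ℕ} : Exec W p s m s' → Exec W q s' n s'' →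
      Exec W (.seq p q) s (m + n) s''
  | condTrue {e : Expr} {p q : Program} {s s' : Store} {n : ℕ} : e.Fits W s → e.eval s ≠ 0 →
      Exec W p s n s' → Exec W (.cond e p q) s (e.cost + 1 + n) s'
  | condFalse {e : Expr} {p q : Program} {s s' : Store} {n : ℕ} : e.Fits W s → e.eval s = 0 →
      Exec W q s n s' → Exec W (.cond e p q) s (e.cost + 1 + n) s'
  | loopTrue {e : Expr} {p : Program} {s s' s'' : Store} {m n : ℕ} : e.Fits W s → e.eval s ≠ 0 →
      Exec W p s m s' → Exec W (.loop e p) s' n s'' →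
      Exec W (.loop e p) s (e.cost + 1 + m + n) s''
  | loopFalse {e : Expr} {p : Program} {s : Store} : e.Fits W s → e.eval s = 0 →
      Exec W (.loop e p) s (e.cost + 1) s

end RAM

/-! Strong detectability fails exactly when arbitrarily long observations leave two distinct current
states possible, one of which can still run with infinite output (`Ambiguous`). A bad prefix of an
infinite word has among its possible states the live state of the run itself; conversely, a live
state extends its observation to an infinite word.

Finiteness turns length into cycles. If no observable closed walk lies between two states, then
"reachable with nonempty output" is a well-founded strict order on the states in between, so the
words leading from one to the other have bounded length (`exists_bound_of_no_cycle`). In the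
automaton itself this identifies liveness with reaching an observable cycle. In the concurrent
composition, whose runs are the pairs of runs with equal label sequences (`Steps.of_cc`,
`Steps.to_cc`), it yields the cycle criterion, and pumping the cycle gives the converse. The
conditions on strongly connected components say the same, because such a component contains an
observable transition iff an observable closed walk passes through any given state of it
(`obsAut_hasObsSCC`).

The algorithm does not compute components. A pair stays possible for arbitrarily long observations
iff it ends arbitrarily long paths of synchronized observable steps from initial pairs
(`ambiguous_iff_path`); a state is live iff it ends arbitrarily long paths of reversed observable
steps (`live_iff_path`). Such nodes are what remains after peeling: nodes not reachable from the
start set are deleted, and then any node all of whose predecessors are deleted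
(`not_sat_iff_unbounded`). Reachability and peeling are both threshold saturations on `|X|^2` nodes,
done in `|X|^2` rounds of `O(|X|^2)` operations (`does_sat`). The dominant cost is the matrix of
synchronized steps: `|X|^4` entries, each a double sum over events.

On the machine level, all data are computed by arithmetic terms with bounded sums and maxima, whose
compilation comes with syntactic bounds on time and word length (`exec_comp`, `does_tab`). -/

namespace LSTS

variable {X T Y : Type*}

/-! ## Finite event sequences -/

section Steps

variable {S : LSTS X T Y} {x y z : X} {s u : List T}

@[simp] theorem word_nil : S.word [] = [] := rfl

@[simp] theorem word_append : S.word (s ++ u) = S.word s ++ S.word u :=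
  List.filterMap_append

theorem word_cons_none {t : T} (h : S.label t = none) : S.word (t :: s) = S.word s := by
  simp [word, h]

theorem word_cons_some {t : T} {c : Y} (h : S.label t = some c) :
    S.word (t :: s) = c :: S.word s := by
  simp [word, h]

theorem Steps.append (h : S.Steps x s y) (h' : S.Steps y u z) : S.Steps x (s ++ u) z := by
  induction h with
  | nil => exact h'
  | cons ht _ ih => exact .cons ht (ih h')

theorem steps_append_iff : S.Steps x (s ++ u) z ↔ ∃ y, S.Steps x s y ∧ S.Steps y u z := by
  refine ⟨fun h => ?_, fun ⟨y, h, h'⟩ => h.append h'⟩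
  induction s generalizing x with
  | nil => exact ⟨x, .nil x, h⟩
  | cons t s ih =>
    cases h with
    | cons ht h =>
      obtain ⟨y, h1, h2⟩ := ih h
      exact ⟨y, .cons ht h1, h2⟩

theorem Steps.single {t : T} (h : S.trans x t y) : S.Steps x [t] y := .cons h (.nil y)

theorem CanReach.refl (x : X) : S.CanReach x x := ⟨[], .nil x⟩

theorem CanReach.trans (h : S.CanReach x y) (h' : S.CanReach y z) : S.CanReach x z := by
  obtain ⟨s, hs⟩ := h
  obtain ⟨u, hu⟩ := h'
  exact ⟨_, hs.append hu⟩

theorem Steps.split_word {w₁ w₂ : List Y} (h : S.Steps x s y) (hw : S.word s = w₁ ++ w₂) :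
    ∃ a b z, S.Steps x a z ∧ S.word a = w₁ ∧ S.Steps z b y ∧ S.word b = w₂ := by
  obtain ⟨a, b, rfl, ha, hb⟩ := List.filterMap_eq_append_iff.1 hw
  obtain ⟨z, h1, h2⟩ := steps_append_iff.1 h
  exact ⟨a, b, z, h1, ha, h2, hb⟩

theorem Steps.split_cons {c : Y} {w : List Y} (h : S.Steps x s y) (hw : S.word s = c :: w) :
    ∃ a t b u v, S.Steps x a u ∧ S.word a = [] ∧ S.trans u t v ∧ S.label t = some c ∧
      S.Steps v b y ∧ S.word b = w := by
  obtain ⟨a, t, b, rfl, ha, ht, hb⟩ := List.filterMap_eq_cons_iff.1 hw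
  obtain ⟨u, h1, h2⟩ := steps_append_iff.1 h
  cases h2 with
  | cons h2 h3 => exact ⟨a, t, b, u, _, h1, List.filterMap_eq_nil_iff.2 ha, h2, ht, h3, hb⟩

theorem Steps.exists_path (h : S.Steps x s y) :
    ∃ f : ℕ → X, f 0 = x ∧ f s.length = y ∧ ∀ i (hi : i < s.length), S.trans (f i) s[i] (f (i + 1)) := by
  induction h with
  | nil x => exact ⟨fun _ => x, rfl, rfl, fun i hi => by simp at hi⟩
  | @cons x y z t s ht _ ih =>
    obtain ⟨f, h0, h1, h2⟩ := ih
    refine ⟨fun n => n.casesOn x f, rfl, h1, fun i hi => ?_⟩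
    cases i with
    | zero => simpa [h0] using ht
    | succ i => exact h2 i (by simpa using hi)

/-- An observable closed walk passes through a state on the way from `x` to `y`, or else the words
that lead from `x` to `y` have bounded length. -/
theorem exists_bound_of_no_cycle [Finite X]
    (hc : ¬ ∃ z u, S.CanReach x z ∧ S.Steps z u z ∧ S.word u ≠ [] ∧ S.CanReach z y) :
    ∃ k, ∀ s, S.Steps x s y → (S.word s).length ≤ k := by
  -- `z'` lies below `z` if it is reached from `z` with output and both lie between `x` and `y`.
  -- Irreflexivity is the absence of a cycle, so finiteness gives well-foundedness; the bound at `z`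
  -- is one more than the maximum over the states below it.
  let r : X → X → Prop := fun z' z =>
    S.CanReach x z ∧ S.CanReach z' y ∧ ∃ s, S.Steps z s z' ∧ S.word s ≠ []
  have : IsTrans X r := ⟨fun a b c ⟨_, h2, s, h3, h4⟩ ⟨h1', _, s', h3', _⟩ =>
    ⟨h1', h2, s' ++ s, h3'.append h3, by simp [h4]⟩⟩
  have : Std.Irrefl r := ⟨fun a ⟨h1, h2, s, h3, h4⟩ => hc ⟨a, s, h1, h3, h4, h2⟩⟩
  have wf : WellFounded r := Finite.wellFounded_of_trans_of_irrefl r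
  suffices h : ∀ z, S.CanReach x z → ∃ k, ∀ s, S.Steps z s y → (S.word s).length ≤ k from
    h x (.refl x)
  intro z
  induction z using wf.induction with
  | _ z ih =>
    intro hz
    -- The condition is moved inside the existential, so that `choose` yields a function on all of
    -- `X`, whose range is finite and hence bounded.
    have ih' : ∀ z', ∃ k, r z' z → ∀ s, S.Steps z' s y → (S.word s).length ≤ k := by
      intro z'
      by_cases h : r z' z
      · obtain ⟨k, hk⟩ := ih z' h (hz.trans ⟨_, h.2.2.choose_spec.1⟩)
        exact ⟨k, fun _ => hk⟩
      · exact ⟨0, fun h' => absurd h' h⟩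
    choose k hk using ih'
    obtain ⟨m, hm⟩ := (Set.finite_range k).bddAbove
    refine ⟨m + 1, fun s hs => ?_⟩
    cases hw : S.word s with
    | nil => simp
    | cons c w =>
      obtain ⟨a, t, b, u, v, h1, h2, h3, h4, h5, h6⟩ := hs.split_cons hw
      have := hk v ⟨hz, ⟨b, h5⟩, a ++ [t], h1.append (.single h3), by
        simp [word_cons_some h4]⟩ b h5
      have h7 : k v ≤ m := hm ⟨v, rfl⟩
      rw [h6] at this
      simp only [List.length_cons]
      omega

theorem Steps.iterate (h : S.Steps x s x) (n : ℕ) :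
    S.Steps x (List.replicate n s).flatten x := by
  induction n with
  | zero => exact .nil x
  | succ n ih => exact h.append ih

theorem length_le_word_iterate (h : S.word s ≠ []) (n : ℕ) :
    n ≤ (S.word (List.replicate n s).flatten).length := by
  induction n with
  | zero => simp
  | succ n ih =>
    have := List.length_pos_iff.2 h
    rw [List.replicate_succ, List.flatten_cons, word_append, List.length_append]
    omega

end Steps

/-! ## Infinite event sequences -/

section Runs

variable {S : LSTS X T Y} {x y : X}

/-- An infinite event sequence with infinite label sequence can be run from `x`, through the
states `p i`. -/
def IsObsRun (S : LSTS X T Y) (x : X) (p : ℕ → X) (τ : ℕ → T) : Prop :=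
  p 0 = x ∧ (∀ i, S.trans (p i) (τ i) (p (i + 1))) ∧
    ∀ m, ∃ n, m ≤ (S.word (takePrefix τ n)).length

/-- An infinite event sequence with infinite label sequence can be run from `x`. -/
def Live (S : LSTS X T Y) (x : X) : Prop :=
  ∃ p τ, S.IsObsRun x p τ

theorem takePrefix_succ {A : Type*} (a : ℕ → A) (n : ℕ) :
    takePrefix a (n + 1) = takePrefix a n ++ [a n] := by
  simp [takePrefix, List.range_succ]

theorem takePrefix_succ' {A : Type*} (a : ℕ → A) (n : ℕ) :
    takePrefix a (n + 1) = a 0 :: takePrefix (fun i => a (i + 1)) n := by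
  simp [takePrefix, List.range_succ_eq_map, Function.comp_def]

@[simp] theorem length_takePrefix {A : Type*} (a : ℕ → A) (n : ℕ) :
    (takePrefix a n).length = n := by
  simp [takePrefix]

theorem takePrefix_add {A : Type*} (a : ℕ → A) (m n : ℕ) :
    takePrefix a (m + n) = takePrefix a m ++ takePrefix (fun i => a (m + i)) n := by
  simp [takePrefix, List.range_add, Function.comp_def]

theorem word_takePrefix_prefix (τ : ℕ → T) {m n : ℕ} (h : m ≤ n) :
    S.word (takePrefix τ m) <+: S.word (takePrefix τ n) := by
  obtain ⟨k, rfl⟩ := Nat.exists_eq_add_of_le h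
  exact ⟨_, by rw [takePrefix_add, word_append]⟩

theorem word_takePrefix_eq_of_length (τ : ℕ → T) {m n : ℕ}
    (h : (S.word (takePrefix τ m)).length = (S.word (takePrefix τ n)).length) :
    S.word (takePrefix τ m) = S.word (takePrefix τ n) := by
  rcases le_total m n with h' | h'
  · exact (word_takePrefix_prefix τ h').eq_of_length h
  · exact ((word_takePrefix_prefix τ h').eq_of_length h.symm).symm

theorem steps_takePrefix {p : ℕ → X} {τ : ℕ → T} (h : ∀ i, S.trans (p i) (τ i) (p (i + 1)))
    (n : ℕ) : S.Steps (p 0) (takePrefix τ n) (p n) := by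
  induction n with
  | zero => exact .nil _
  | succ n ih => rw [takePrefix_succ]; exact ih.append (.single (h n))

theorem unbounded_of_frequently {τ : ℕ → T} (h : ∀ m, ∃ n, m ≤ n ∧ S.label (τ n) ≠ none) (m : ℕ) :
    ∃ n, m ≤ (S.word (takePrefix τ n)).length := by
  induction m with
  | zero => exact ⟨0, Nat.zero_le _⟩
  | succ m ih =>
    obtain ⟨n, hn⟩ := ih
    obtain ⟨n', h1, h2⟩ := h n
    obtain ⟨c, hc⟩ := Option.ne_none_iff_exists'.1 h2
    refine ⟨n' + 1, ?_⟩
    have := (word_takePrefix_prefix (S := S) τ h1).length_le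
    rw [takePrefix_succ, word_append, List.length_append, word_cons_some hc]
    simp
    omega

/-- One event produces at most one output, so the output length skips no value. -/
theorem exists_word_length_eq {τ : ℕ → T}
    (h : ∀ m, ∃ n, m ≤ (S.word (takePrefix τ n)).length) (m : ℕ) :
    ∃ n, (S.word (takePrefix τ n)).length = m := by
  obtain ⟨n, hn⟩ := h m
  induction n with
  | zero => exact ⟨0, by simp [takePrefix] at hn ⊢; exact hn.symm⟩
  | succ n ih =>
    by_cases h' : m ≤ (S.word (takePrefix τ n)).length
    · exact ih h'
    · refine ⟨n + 1, le_antisymm ?_ hn⟩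
      have : (S.word [τ n]).length ≤ 1 := List.length_filterMap_le _ _
      rw [takePrefix_succ, word_append, List.length_append]
      omega

/-- Letter `m` is read from any prefix with more than `m` outputs; the prefixes are nested, so the
choice does not matter. -/
theorem exists_hasLabel {τ : ℕ → T} (h : ∀ m, ∃ n, m ≤ (S.word (takePrefix τ n)).length) :
    ∃ σ, S.HasLabel τ σ := by
  choose n hn using fun m => h (m + 1)
  refine ⟨fun m => (S.word (takePrefix τ (n m)))[m]'(hn m), fun m => ?_⟩
  obtain ⟨k, hk⟩ := exists_word_length_eq h m
  refine ⟨k, List.ext_getElem (by simp [hk]) fun i h1 h2 => ?_⟩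
  simp only [takePrefix, List.getElem_map, List.getElem_range]
  change (S.word (takePrefix τ k))[i] = (S.word (takePrefix τ (n i)))[i]'(hn i)
  rcases le_total k (n i) with h' | h'
  · exact (word_takePrefix_prefix τ h').getElem h1
  · exact ((word_takePrefix_prefix τ h').getElem (hn i)).symm

theorem IsObsRun.shift {p : ℕ → X} {τ : ℕ → T} (h : S.IsObsRun x p τ) (n : ℕ) :
    S.IsObsRun (p n) (fun i => p (n + i)) (fun i => τ (n + i)) := by
  refine ⟨rfl, fun i => h.2.1 (n + i), fun m => ?_⟩
  obtain ⟨k, hk⟩ := h.2.2 ((S.word (takePrefix τ n)).length + m)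
  refine ⟨k, ?_⟩
  have := (word_takePrefix_prefix (S := S) τ (Nat.le_add_left k n)).length_le
  rw [takePrefix_add, word_append, List.length_append] at this
  omega

theorem IsObsRun.prepend {p : ℕ → X} {τ : ℕ → T} {s : List T} (hs : S.Steps x s y)
    (h : S.IsObsRun y p τ) : ∃ p' τ', S.IsObsRun x p' τ' ∧ takePrefix τ' s.length = s := by
  induction hs with
  | nil x => exact ⟨p, τ, h, rfl⟩
  | @cons x y z t s ht _ ih =>
    obtain ⟨p', τ', ⟨h0, h1, h2⟩, h3⟩ := ih h
    refine ⟨fun n => n.casesOn x p', fun n => n.casesOn t τ', ⟨rfl, fun i => ?_, fun m => ?_⟩, ?_⟩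
    · cases i with
      | zero => simpa [h0] using ht
      | succ i => exact h1 i
    · obtain ⟨n, hn⟩ := h2 m
      refine ⟨n + 1, hn.trans ?_⟩
      rw [takePrefix_succ', ← List.singleton_append, word_append, List.length_append]
      exact Nat.le_add_left _ _
    · rw [List.length_cons, takePrefix_succ']
      exact congrArg _ h3

theorem Live.of_steps {s : List T} (hs : S.Steps x s y) (h : S.Live y) : S.Live x := by
  obtain ⟨p, τ, h⟩ := h
  obtain ⟨p', τ', h', -⟩ := h.prepend hs
  exact ⟨p', τ', h'⟩

theorem Live.of_cycle {u : List T} (hu : S.Steps x u x) (hw : S.word u ≠ []) : S.Live x := by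
  obtain ⟨f, h0, h1, h2⟩ := hu.exists_path
  have hL : 0 < u.length := by
    rcases u with _ | ⟨t, u⟩
    · simp at hw
    · simp
  refine ⟨fun n => f (n % u.length), fun n => u[n % u.length]'(Nat.mod_lt _ hL), ?_, fun i => ?_,
    unbounded_of_frequently fun m => ?_⟩
  · simpa using h0
  · have h3 := h2 (i % u.length) (Nat.mod_lt _ hL)
    have h4 : f ((i + 1) % u.length) = f (i % u.length + 1) := by
      have h5 := Nat.mod_lt i hL
      rw [Nat.add_mod_eq_ite]
      -- A loop of length one is separate because `Nat.add_mod_eq_ite` involves `1 % u.length`,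
      -- which is then `0`. At the end of a round, the path closes up by `h0` and `h1`.
      rcases Nat.lt_or_ge 1 u.length with h6 | h6
      · rw [Nat.mod_eq_of_lt h6]
        split_ifs with h7
        · have h8 : i % u.length + 1 = u.length := by omega
          rw [h8, Nat.sub_self, h0, h1]
        · rfl
      · have h8 : u.length = 1 := by omega
        have h9 : i % u.length + 1 = u.length := by omega
        have h10 : ∀ j, j = 0 → f j = f (i % u.length + 1) := by
          rintro j rfl
          rw [h9, h1, h0]
        apply h10
        simp [h8, Nat.mod_one]
    simpa only [h4] using h3
  · obtain ⟨t, ht, hl⟩ : ∃ t ∈ u, S.label t ≠ none := by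
      by_contra! h
      exact hw (List.filterMap_eq_nil_iff.2 h)
    obtain ⟨i, hi, rfl⟩ := List.getElem_of_mem ht
    refine ⟨u.length * m + i, ?_, ?_⟩
    · nlinarith
    · simpa [Nat.mod_eq_of_lt hi] using hl

/-- Without a reachable observable cycle, the words to each endpoint are bounded; finitely many
endpoints make the bound uniform. -/
theorem reachesObsCycle_of_unbounded [Finite X] (h : ∀ k, ∃ s y, S.Steps x s y ∧ k ≤ (S.word s).length) :
    S.ReachesObsCycle x := by
  by_contra hc
  have : ∀ y, ∃ k, ∀ s, S.Steps x s y → (S.word s).length ≤ k := fun y =>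
    exists_bound_of_no_cycle fun ⟨z, u, ⟨s, hs⟩, hu, hw, _⟩ => hc ⟨z, s, u, hs, hu, hw⟩
  choose k hk using this
  obtain ⟨m, hm⟩ := (Set.finite_range k).bddAbove
  obtain ⟨s, y, hs, hl⟩ := h (m + 1)
  have h1 := hk y s hs
  have h2 : k y ≤ m := hm ⟨y, rfl⟩
  omega

theorem ReachesObsCycle.live (h : S.ReachesObsCycle x) : S.Live x := by
  obtain ⟨y, s, u, hs, hu, hw⟩ := h
  exact (Live.of_cycle hu hw).of_steps hs

theorem Live.unbounded (h : S.Live x) (k : ℕ) :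
    ∃ s y, S.Steps x s y ∧ k ≤ (S.word s).length := by
  obtain ⟨p, τ, rfl, h1, h2⟩ := h
  obtain ⟨n, hn⟩ := h2 k
  exact ⟨_, _, steps_takePrefix h1 n, hn⟩

theorem live_iff_reachesObsCycle [Finite X] : S.Live x ↔ S.ReachesObsCycle x :=
  ⟨fun h => reachesObsCycle_of_unbounded h.unbounded, ReachesObsCycle.live⟩

theorem live_iff_unbounded [Finite X] :
    S.Live x ↔ ∀ k, ∃ s y, S.Steps x s y ∧ k ≤ (S.word s).length :=
  ⟨Live.unbounded, fun h => (reachesObsCycle_of_unbounded h).live⟩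

theorem omegaLanguage_nonempty_iff : S.omegaLanguage.Nonempty ↔ ∃ x ∈ S.init, S.Live x := by
  constructor
  · rintro ⟨σ, τ, ⟨p, h0, h1⟩, h2⟩
    refine ⟨p 0, h0, p, τ, rfl, h1, fun m => ?_⟩
    obtain ⟨n, hn⟩ := h2 m
    exact ⟨n, by simp [hn]⟩
  · rintro ⟨x, hx, p, τ, rfl, h1, h2⟩
    obtain ⟨σ, hσ⟩ := exists_hasLabel h2
    exact ⟨σ, τ, ⟨p, hx, h1⟩, hσ⟩

/-- Arbitrarily long output sequences leave the current state open, and can be continued. -/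
def Ambiguous (S : LSTS X T Y) : Prop :=
  ∀ k, ∃ w : List Y, k < w.length ∧ ∃ x ∈ S.possibleStates w, ∃ y ∈ S.possibleStates w,
    x ≠ y ∧ S.Live x

/-- Liveness of only one of the two states suffices: it makes the observation a prefix of an
infinite word, while the other state need only be possible. No finiteness is used. -/
theorem not_stronglyDetectable_iff : ¬ S.StronglyDetectable ↔ S.Ambiguous := by
  constructor
  · intro h k
    simp only [StronglyDetectable, not_exists, not_and, not_forall] at h
    -- `k + 1`, since the definition admits positive bounds only.
    obtain ⟨σ, ⟨τ, ⟨p, h0, h1⟩, h2⟩, m, hm, hc⟩ := h (k + 1) k.succ_pos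
    obtain ⟨n, hn⟩ := h2 m
    have hmem : p n ∈ S.possibleStates (takePrefix σ m) :=
      ⟨p 0, h0, _, hn, steps_takePrefix h1 n⟩
    have hrun : S.IsObsRun (p 0) p τ := ⟨rfl, h1, fun m => by
      obtain ⟨n, hn⟩ := h2 m
      exact ⟨n, by simp [hn]⟩⟩
    refine ⟨_, by simpa using Nat.lt_of_succ_lt hm, p n, hmem, ?_⟩
    by_contra! hall
    refine hc (Set.encard_eq_one.2 ⟨p n, Set.eq_singleton_iff_unique_mem.2 ⟨hmem, fun y hy => ?_⟩⟩)
    by_contra hne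
    exact hall y hy (Ne.symm hne) ⟨_, _, hrun.shift n⟩
  · rintro h ⟨k, -, hk⟩
    obtain ⟨w, hw, x, hx, y, hy, hne, p, τ, hrun⟩ := h k
    obtain ⟨x₀, h0, s, rfl, hs⟩ := id hx
    obtain ⟨p', τ', ⟨h1, h2, h3⟩, h4⟩ := hrun.prepend hs
    obtain ⟨σ, hσ⟩ := exists_hasLabel h3
    have h5 := hk σ ⟨τ', ⟨p', h1 ▸ h0, h2⟩, hσ⟩ _ hw
    obtain ⟨n, hn⟩ := hσ (S.word s).length
    -- Both sides are outputs of prefixes of `τ'` with the same output length.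
    have h6 : takePrefix σ (S.word s).length = S.word s := by
      rw [← hn]
      conv_rhs => rw [← h4]
      apply word_takePrefix_eq_of_length
      rw [hn, h4]
      simp
    rw [h6, Set.encard_eq_one] at h5
    obtain ⟨z, hz⟩ := h5
    rw [hz] at hx hy
    exact hne (hx.trans hy.symm)

end Runs

end LSTS

namespace LSTS

/-! ## Accessible parts, concurrent compositions and observation automata -/

section Constructions

variable {X T Y : Type*} {S : LSTS X T Y}

theorem Steps.mono {Y' : Type*} {S' : LSTS X T Y'} (h : ∀ x t y, S.trans x t y → S'.trans x t y)
    {x y : X} {s : List T} (hs : S.Steps x s y) : S'.Steps x s y := by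
  induction hs with
  | nil x => exact .nil x
  | cons ht _ ih => exact .cons (h _ _ _ ht) ih

theorem Steps.of_acc {x y : {x : X // S.Reachable x}} {s : List T} (h : S.acc.Steps x s y) :
    S.Steps x.1 s y.1 := by
  induction h with
  | nil x => exact .nil _
  | cons ht _ ih => exact .cons ht ih

theorem Reachable.of_steps {x y : X} {s : List T} (hx : S.Reachable x) (h : S.Steps x s y) :
    S.Reachable y := by
  obtain ⟨x₀, h0, u, hu⟩ := hx
  exact ⟨x₀, h0, _, hu.append h⟩

theorem Steps.to_acc {x y : X} {s : List T} (h : S.Steps x s y) (hx : S.Reachable x) :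
    S.acc.Steps ⟨x, hx⟩ s ⟨y, hx.of_steps h⟩ := by
  induction h with
  | nil x => exact .nil _
  | cons ht _ ih => exact .cons (S := S.acc) (y := ⟨_, hx.of_steps (.single ht)⟩) ht (ih _)

theorem acc_reachable (x : {x : X // S.Reachable x}) :
    ∃ x₀ ∈ S.acc.init, ∃ s, S.acc.Steps x₀ s x := by
  obtain ⟨x₀, h0, s, hs⟩ := x.2
  exact ⟨⟨x₀, x₀, h0, [], .nil _⟩, h0, s, hs.to_acc _⟩

theorem acc_reachesObsCycle {x : {x : X // S.Reachable x}} :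
    S.acc.ReachesObsCycle x ↔ S.ReachesObsCycle x.1 := by
  constructor
  · rintro ⟨y, s, u, hs, hu, hw⟩
    exact ⟨y.1, s, u, hs.of_acc, hu.of_acc, hw⟩
  · rintro ⟨y, s, u, hs, hu, hw⟩
    exact ⟨_, s, u, hs.to_acc x.2, hu.to_acc _, hw⟩

theorem mem_possibleStates_acc {x : {x : X // S.Reachable x}} {w : List Y} :
    x ∈ S.acc.possibleStates w ↔ x.1 ∈ S.possibleStates w := by
  constructor
  · rintro ⟨x₀, h0, s, hw, hs⟩
    exact ⟨x₀.1, h0, s, hw, hs.of_acc⟩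
  · rintro ⟨x₀, h0, s, hw, hs⟩
    exact ⟨⟨x₀, x₀, h0, [], .nil _⟩, h0, s, hw, hs.to_acc _⟩

theorem reachable_of_mem_possibleStates {x : X} {w : List Y} (h : x ∈ S.possibleStates w) :
    S.Reachable x := by
  obtain ⟨x₀, h0, s, -, hs⟩ := h
  exact ⟨x₀, h0, s, hs⟩

theorem Steps.of_cc {p q : X × X} {e : List S.CCEvent} (h : S.cc.Steps p e q) :
    ∃ s s', S.Steps p.1 s q.1 ∧ S.Steps p.2 s' q.2 ∧ S.word s = S.cc.word e ∧
      S.word s' = S.cc.word e := by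
  induction h with
  | nil p => exact ⟨[], [], .nil _, .nil _, rfl, rfl⟩
  | @cons p q r t e ht _ ih =>
    obtain ⟨s, s', h1, h2, h3, h4⟩ := ih
    cases t with
    | both t t' hl ho =>
      obtain ⟨c, hc⟩ := Option.ne_none_iff_exists'.1 ho
      refine ⟨t :: s, t' :: s', .cons ht.1 h1, .cons ht.2 h2, ?_, ?_⟩
      · rw [word_cons_some hc, word_cons_some (S := S.cc) (t := .both t t' hl ho) hc, h3]
      · rw [word_cons_some (hl ▸ hc), word_cons_some (S := S.cc) (t := .both t t' hl ho) hc, h4]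
    | left t hl =>
      refine ⟨t :: s, s', .cons ht.1 h1, ht.2 ▸ h2, ?_, ?_⟩
      · rw [word_cons_none hl, word_cons_none (S := S.cc) rfl, h3]
      · rw [word_cons_none (S := S.cc) rfl, h4]
    | right t hl =>
      refine ⟨s, t :: s', ht.1 ▸ h1, .cons ht.2 h2, ?_, ?_⟩
      · rw [word_cons_none (S := S.cc) rfl, h3]
      · rw [word_cons_none hl, word_cons_none (S := S.cc) rfl, h4]

theorem cc_trans_left {x y z : X} {t : T} (ht : S.trans x t y) (h : S.label t = none) :
    S.cc.trans (x, z) (.left t h) (y, z) := ⟨ht, rfl⟩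

theorem cc_trans_right {x y z : X} {t : T} (ht : S.trans x t y) (h : S.label t = none) :
    S.cc.trans (z, x) (.right t h) (z, y) := ⟨rfl, ht⟩

theorem cc_trans_both {x y x' y' : X} {t t' : T} (ht : S.trans x t y) (ht' : S.trans x' t' y')
    (h : S.label t = S.label t') (ho : S.label t ≠ none) :
    S.cc.trans (x, x') (.both t t' h ho) (y, y') := ⟨ht, ht'⟩

/-- Interleave the two runs: unobservable events move one component alone, and the observable ones
match in order because the words agree. -/
theorem Steps.to_cc {x y x' y' : X} {s s' : List T} (h : S.Steps x s y) (h' : S.Steps x' s' y')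
    (hw : S.word s = S.word s') :
    ∃ e, S.cc.Steps (x, x') e (y, y') ∧ S.cc.word e = S.word s := by
  induction h generalizing x' s' with
  | nil x =>
    induction h' with
    | nil => exact ⟨[], .nil _, rfl⟩
    | @cons x' y' z' t s' ht _ ih =>
      cases hl : S.label t with
      | none =>
        rw [word_cons_none hl] at hw
        obtain ⟨e, h1, h2⟩ := ih hw
        exact ⟨.right t hl :: e, .cons (cc_trans_right ht hl) h1, by
          rw [word_cons_none (S := S.cc) rfl, h2]⟩
      | some c => simp [word_cons_some hl] at hw
  | @cons x z y t s ht hs ih =>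
    cases hl : S.label t with
    | none =>
      rw [word_cons_none hl] at hw
      obtain ⟨e, h1, h2⟩ := ih h' hw
      exact ⟨.left t hl :: e, .cons (cc_trans_left ht hl) h1, by
        rw [word_cons_none (S := S.cc) rfl, word_cons_none hl, h2]⟩
    | some c =>
      rw [word_cons_some hl] at hw
      -- The left run now waits at an observable event, while the unobservable events of the right
      -- run are consumed up to the matching one.
      induction h' with
      | nil => simp at hw
      | @cons x' z' y' t' s' ht' hs' ih' =>
        cases hl' : S.label t' with
        | none =>
          rw [word_cons_none hl'] at hw
          obtain ⟨e, h1, h2⟩ := ih' ih hw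
          exact ⟨.right t' hl' :: e, .cons (cc_trans_right ht' hl') h1, by
            rw [word_cons_none (S := S.cc) rfl, h2]⟩
        | some c' =>
          rw [word_cons_some hl', List.cons.injEq] at hw
          obtain ⟨e, h1, h2⟩ := ih hs' hw.2
          have hb : S.label t = S.label t' := by rw [hl, hl', hw.1]
          have ho : S.label t ≠ none := by simp [hl]
          refine ⟨.both t t' hb ho :: e, .cons (cc_trans_both ht ht' hb ho) h1, ?_⟩
          rw [word_cons_some (S := S.cc) (t := .both t t' hb ho) hl, word_cons_some hl, h2]

theorem obsAut_canReach {x y : X} : S.obsAut.CanReach x y ↔ S.CanReach x y := by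
  constructor
  · rintro ⟨s, hs⟩
    induction hs with
    | nil x => exact .refl x
    | @cons x y z b s ht _ ih =>
      obtain ⟨t, ht⟩ : ∃ t, S.trans x t y := by
        cases b with
        | true => exact ht.imp fun _ h => h.1
        | false => exact ht.1
      exact CanReach.trans ⟨_, .single ht⟩ ih
  · rintro ⟨s, hs⟩
    induction hs with
    | nil x => exact .refl x
    | @cons x y z t s ht _ ih =>
      obtain ⟨b, hb⟩ : ∃ b, S.obsAut.trans x b y := by
        by_cases h : ∃ t, S.trans x t y ∧ S.label t ≠ none
        · exact ⟨true, h⟩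
        · exact ⟨false, ⟨t, ht⟩, fun t ht => by_contra fun hl => h ⟨t, ht, hl⟩⟩
      exact CanReach.trans ⟨_, .single hb⟩ ih

/-- An observable transition within the component of `x` is completed to a closed walk through `x`;
conversely, every transition of a closed walk through `x` stays in its component. -/
theorem obsAut_hasObsSCC {x : X} :
    S.obsAut.HasObsSCC x ↔ ∃ u, S.Steps x u x ∧ S.word u ≠ [] := by
  constructor
  · rintro ⟨y, z, b, ⟨hy, -⟩, ⟨-, hz⟩, ht, hl⟩
    obtain ⟨s, hs⟩ := obsAut_canReach.1 hy
    obtain ⟨u, hu⟩ := obsAut_canReach.1 hz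
    cases b with
    | false => exact absurd rfl hl
    | true =>
      obtain ⟨t, ht, hl⟩ := ht
      obtain ⟨c, hc⟩ := Option.ne_none_iff_exists'.1 hl
      exact ⟨s ++ t :: u, hs.append (.cons ht hu), by simp [word_cons_some hc]⟩
  · rintro ⟨u, hu, hw⟩
    obtain ⟨c, w, hw⟩ := List.exists_cons_of_ne_nil hw
    obtain ⟨a, t, b, y, z, h1, -, h3, h4, h5, -⟩ := hu.split_cons hw
    refine ⟨y, z, true, ⟨?_, ?_⟩, ⟨?_, ?_⟩, ⟨t, h3, by simp [h4]⟩, by simp [obsAut]⟩ <;>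
      rw [obsAut_canReach]
    exacts [⟨_, h1⟩, ⟨_, .cons h3 h5⟩, ⟨_, h1.append (.single h3)⟩, ⟨_, h5⟩]

end Constructions

/-! ## Characterizations of strong detectability -/

section Criteria

variable {X T Y : Type*} {S : LSTS X T Y}

theorem mem_possibleStates_of_steps {p₀ p : {p // S.acc.cc.Reachable p}}
    {e : List S.acc.CCEvent} (h0 : p₀ ∈ S.acc.cc.acc.init) (h : S.acc.cc.acc.Steps p₀ e p) :
    p.1.1.1 ∈ S.possibleStates (S.acc.cc.acc.word e) ∧
      p.1.2.1 ∈ S.possibleStates (S.acc.cc.acc.word e) := by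
  obtain ⟨s, s', h1, h2, h3, h4⟩ := h.of_acc.of_cc
  exact ⟨⟨_, h0.1, s, h3, h1.of_acc⟩, ⟨_, h0.2, s', h4, h2.of_acc⟩⟩

theorem exists_steps_of_mem_possibleStates {x y : X} {w : List Y} (hx : x ∈ S.possibleStates w)
    (hy : y ∈ S.possibleStates w) :
    ∃ p₀ ∈ S.acc.cc.acc.init, ∃ e p, S.acc.cc.acc.Steps p₀ e p ∧ S.acc.cc.acc.word e = w ∧
      p.1.1.1 = x ∧ p.1.2.1 = y := by
  obtain ⟨x₀, hx0, s, hs, hsx⟩ :=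
    (mem_possibleStates_acc (x := ⟨x, reachable_of_mem_possibleStates hx⟩)).2 hx
  obtain ⟨y₀, hy0, s', hs', hsy⟩ :=
    (mem_possibleStates_acc (x := ⟨y, reachable_of_mem_possibleStates hy⟩)).2 hy
  obtain ⟨e, he, hw⟩ := hsx.to_cc hsy (hs.trans hs'.symm)
  have h0 : (x₀, y₀) ∈ S.acc.cc.init := ⟨hx0, hy0⟩
  exact ⟨⟨(x₀, y₀), _, h0, [], .nil _⟩, h0, e, _, he.to_acc _, hw.trans hs, rfl, rfl⟩

/-- Running through the cycle `k + 1` times yields more than `k` outputs. -/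
theorem unbounded_of_cycle {p₀ q p : {p // S.acc.cc.Reachable p}} {e u v : List S.acc.CCEvent}
    (h0 : p₀ ∈ S.acc.cc.acc.init) (h1 : S.acc.cc.acc.Steps p₀ e q)
    (h2 : S.acc.cc.acc.Steps q u q) (h3 : S.acc.cc.acc.Steps q v p)
    (hw : S.acc.cc.acc.word u ≠ []) (k : ℕ) :
    ∃ w : List Y, k < w.length ∧ p.1.1.1 ∈ S.possibleStates w ∧ p.1.2.1 ∈ S.possibleStates w := by
  refine ⟨_, ?_, mem_possibleStates_of_steps h0 ((h1.append (h2.iterate (k + 1))).append h3)⟩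
  have := length_le_word_iterate hw (k + 1)
  rw [word_append, word_append, List.length_append, List.length_append]
  omega

theorem CycleCriterion.ambiguous (h : S.CycleCriterion) : S.Ambiguous := by
  obtain ⟨p₀, h0, q, p, e, u, v, h1, h2, h3, hw, hne, hr⟩ := h
  intro k
  obtain ⟨w, hk, hx, hy⟩ := unbounded_of_cycle h0 h1 h2 h3 hw k
  exact ⟨w, hk, _, hx, _, hy, fun h => hne (Subtype.ext h), hr.live⟩

/-- If the criterion fails, no observable closed walk lies between an initial pair and a pair with
distinct components and live left component. Each such choice of endpoints then has bounded words,
and there are finitely many choices. -/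
theorem Ambiguous.cycleCriterion [Finite X] (h : S.Ambiguous) : S.CycleCriterion := by
  by_contra hc
  have : ∀ i : {p // S.acc.cc.Reachable p} × {p // S.acc.cc.Reachable p}, ∃ k,
      i.1 ∈ S.acc.cc.acc.init → i.2.1.1 ≠ i.2.1.2 → S.Live i.2.1.1.1 →
        ∀ e, S.acc.cc.acc.Steps i.1 e i.2 → (S.acc.cc.acc.word e).length ≤ k := by
    rintro ⟨p₀, p⟩
    by_cases h' : p₀ ∈ S.acc.cc.acc.init ∧ p.1.1 ≠ p.1.2 ∧ S.Live p.1.1.1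
    · obtain ⟨k, hk⟩ := exists_bound_of_no_cycle (S := S.acc.cc.acc) (x := p₀) (y := p)
        fun ⟨q, u, ⟨e, h1⟩, h2, hw, ⟨v, h3⟩⟩ =>
          hc ⟨p₀, h'.1, q, p, e, u, v, h1, h2, h3, hw, h'.2.1, live_iff_reachesObsCycle.1 h'.2.2⟩
      exact ⟨k, fun _ _ _ => hk⟩
    · exact ⟨0, fun h1 h2 h3 => absurd ⟨h1, h2, h3⟩ h'⟩
  choose k hk using this
  obtain ⟨m, hm⟩ := (Set.finite_range k).bddAbove
  obtain ⟨w, hw, x, hx, y, hy, hne, hl⟩ := h m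
  obtain ⟨p₀, h0, e, p, he, rfl, rfl, rfl⟩ := exists_steps_of_mem_possibleStates hx hy
  have h1 := hk (p₀, p) h0 (fun h => hne (congrArg _ h)) hl e he
  have h2 : k (p₀, p) ≤ m := hm ⟨_, rfl⟩
  omega

theorem mem_bifurcated {p : {p // S.acc.cc.Reachable p}} :
    p ∈ S.bifurcated ↔ p.1.1 ≠ p.1.2 ∧ ∃ q u v, S.acc.cc.acc.Steps q u q ∧
      S.acc.cc.acc.word u ≠ [] ∧ S.acc.cc.acc.Steps q v p := by
  simp only [bifurcated, Set.mem_ofPred_eq, obsAut_hasObsSCC, CanReach]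
  refine and_congr_right fun _ => exists_congr fun q => ?_
  exact ⟨fun ⟨⟨u, h1, h2⟩, v, h3⟩ => ⟨u, v, h1, h2, h3⟩, fun ⟨u, v, h1, h2, h3⟩ => ⟨⟨u, h1, h2⟩, v, h3⟩⟩

theorem ambiguous_iff_bifurcated [Finite X] :
    S.Ambiguous ↔ ∃ x ∈ S.restarted.init, S.ReachesObsCycle x.1 := by
  constructor
  · intro h
    obtain ⟨p₀, h0, q, p, e, u, v, h1, h2, h3, hw, hne, hr⟩ := h.cycleCriterion
    exact ⟨p.1.1, ⟨p, mem_bifurcated.2 ⟨hne, q, u, v, h2, hw, h3⟩, .inl rfl⟩, hr⟩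
  · rintro ⟨x, ⟨p, hp, hx⟩, hr⟩ k
    obtain ⟨hne, q, u, v, h2, hw, h3⟩ := mem_bifurcated.1 hp
    obtain ⟨p₀, h0, e, h1⟩ := acc_reachable q
    obtain ⟨w, hk, h4, h5⟩ := unbounded_of_cycle h0 h1 h2 h3 hw k
    rcases hx with rfl | rfl
    · exact ⟨w, hk, _, h4, _, h5, fun h => hne (Subtype.ext h), hr.live⟩
    -- Here the right component is the live one, so the two possible states exchange roles.
    · exact ⟨w, hk, _, h5, _, h4, fun h => hne (Subtype.ext h.symm), hr.live⟩

theorem restarted_reachesObsCycle {x : {x : X // S.Reachable x}} :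
    S.restarted.ReachesObsCycle x ↔ S.ReachesObsCycle x.1 := by
  have h : ∀ x t y, S.restarted.trans x t y → S.acc.trans x t y := fun _ _ _ => id
  have h' : ∀ x t y, S.acc.trans x t y → S.restarted.trans x t y := fun _ _ _ => id
  rw [← acc_reachesObsCycle]
  constructor
  · rintro ⟨y, s, u, hs, hu, hw⟩
    exact ⟨y, s, u, hs.mono h, hu.mono h, hw⟩
  · rintro ⟨y, s, u, hs, hu, hw⟩
    exact ⟨y, s, u, hs.mono h', hu.mono h', hw⟩

theorem exists_obsCycle_acc_iff {A : LSTS X T Y} :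
    (∃ x, A.acc.obsAut.HasObsSCC x) ↔ ∃ x ∈ A.init, A.ReachesObsCycle x := by
  simp only [obsAut_hasObsSCC]
  constructor
  · rintro ⟨x, u, hu, hw⟩
    obtain ⟨x₀, h0, s, hs⟩ := x.2
    exact ⟨x₀, h0, x.1, s, u, hs, hu.of_acc, hw⟩
  · rintro ⟨x, hx, y, s, u, hs, hu, hw⟩
    exact ⟨⟨y, x, hx, s, hs⟩, u, hu.to_acc _, hw⟩

theorem omegaLanguage_acc_nonempty_iff [Finite X] {A : LSTS X T Y} :
    A.acc.omegaLanguage.Nonempty ↔ ∃ x ∈ A.init, A.ReachesObsCycle x := by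
  simp only [omegaLanguage_nonempty_iff, live_iff_reachesObsCycle, acc_reachesObsCycle]
  exact ⟨fun ⟨x, h0, h⟩ => ⟨x.1, h0, h⟩, fun ⟨x, h0, h⟩ => ⟨⟨x, x, h0, [], .nil _⟩, h0, h⟩⟩

theorem not_stronglyDetectable_characterizations [Finite X] (S : LSTS X T Y) :
    (¬ S.StronglyDetectable ↔ S.CycleCriterion) ∧
    (¬ S.StronglyDetectable ↔ S.restarted.acc.omegaLanguage.Nonempty) ∧
    (¬ S.StronglyDetectable ↔ ∃ x, S.restarted.acc.obsAut.HasObsSCC x) := by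
  rw [not_stronglyDetectable_iff, exists_obsCycle_acc_iff, omegaLanguage_acc_nonempty_iff]
  simp only [restarted_reachesObsCycle]
  exact ⟨⟨Ambiguous.cycleCriterion, CycleCriterion.ambiguous⟩, ambiguous_iff_bifurcated,
    ambiguous_iff_bifurcated⟩

end Criteria

end LSTS

/-! ## Structured programs for random access machines -/

namespace RAM

/-- The register that holds the `i`-th size parameter. -/
def szReg (i : Fin 3) : ℕ := i + 1

/-- The register of the loop counter with number `m`. -/
def varReg (m : ℕ) : ℕ := 2 * m + 4

/-- The scratch register with number `d`. -/
def tmpReg (d : ℕ) : ℕ := 2 * d + 5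

/-- Binary operations. -/
inductive Op where
  | plus | minus | times | less | equal

/-- The value of a binary operation. -/
def Op.eval : Op → ℕ → ℕ → ℕ
  | plus, a, b => a + b
  | minus, a, b => a - b
  | times, a, b => a * b
  | less, a, b => if a < b then 1 else 0
  | equal, a, b => if a = b then 1 else 0

/-- The expression that evaluates a binary operation. -/
def Op.expr : Op → Expr → Expr → Expr
  | plus => .plus
  | minus => .minus
  | times => .times
  | less => .less
  | equal => .equal

/-- Arithmetic terms with bounded sums and bounded maxima. Bound variables are de Bruijn levels. -/
inductive Term where
  /-- a constant -/
  | lit (c : ℕ)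
  /-- a size parameter -/
  | size (i : Fin 3)
  /-- a variable -/
  | var (m : ℕ)
  /-- an array cell -/
  | cell (a : ℕ) (e : Term)
  /-- a binary operation -/
  | bin (o : Op) (e f : Term)
  /-- the sum (or maximum, if `b` is true) of the values of `e`, as the next variable runs through
  the numbers less than the size parameter `n` -/
  | fold (b : Bool) (n : Fin 3) (e : Term)

/-- The sum (or maximum, if `b` is true) of the first values of `f`. -/
def foldVal (b : Bool) (f : ℕ → ℕ) : ℕ → ℕ
  | 0 => 0
  | n + 1 => foldVal b f n + (f n - b.toNat * foldVal b f n)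

theorem foldVal_false (f : ℕ → ℕ) (n : ℕ) : foldVal false f n = ∑ i ∈ Finset.range n, f i := by
  induction n with
  | zero => rfl
  | succ n ih => simp [foldVal, ih, Finset.sum_range_succ]

/-- With truncated subtraction, `s + (a - s)` is the maximum of `s` and `a`, which is why one
recursion covers sums and maxima. -/
theorem foldVal_true (f : ℕ → ℕ) (n : ℕ) : foldVal true f n = (Finset.range n).sup f := by
  induction n with
  | zero => rfl
  | succ n ih =>
    rw [Finset.range_add_one, Finset.sup_insert, ← ih, foldVal, Bool.toNat_true, one_mul]
    omega

theorem foldVal_le {b : Bool} {f : ℕ → ℕ} {B : ℕ} {n : ℕ} (h : ∀ i < n, f i ≤ B) :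
    foldVal b f n ≤ n * B := by
  induction n with
  | zero => simp [foldVal]
  | succ n ih =>
    have h1 := ih fun i hi => h i (hi.trans n.lt_succ_self)
    have h2 := h n n.lt_succ_self
    rw [foldVal, Nat.succ_mul]
    omega

theorem foldVal_congr {b : Bool} {f g : ℕ → ℕ} {n : ℕ} (h : ∀ i < n, f i = g i) :
    foldVal b f n = foldVal b g n := by
  induction n with
  | zero => rfl
  | succ n ih =>
    rw [foldVal, foldVal, ih fun i hi => h i (hi.trans n.lt_succ_self), h n n.lt_succ_self]

/-- A counting loop. -/
def forLoop (k : ℕ) (n : Fin 3) (p : Program) : Program :=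
  .seq (.assign (varReg k) (.lit 0)) (.loop (.less (.reg (varReg k)) (.reg (szReg n)))
    (.seq p (.assign (varReg k) (.plus (.reg (varReg k)) (.lit 1)))))

namespace Term

/-- The value of a term with free variables of level less than `k`. -/
def val (sz : Fin 3 → ℕ) (A : ℕ → ℕ → ℕ) : ℕ → (ℕ → ℕ) → Term → ℕ
  | _, _, lit c => c
  | _, _, size i => sz i
  | _, v, var m => v m
  | k, v, cell a e => A a (val sz A k v e)
  | k, v, bin o e f => o.eval (val sz A k v e) (val sz A k v f)
  | k, v, fold b n e =>
    foldVal b (fun j => val sz A (k + 1) (Function.update v k j) e) (sz n)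

/-- The free variables have level less than `k`. -/
def wf : ℕ → Term → Bool
  | _, lit _ => true
  | _, size _ => true
  | k, var m => m < k
  | k, cell _ e => wf k e
  | k, bin _ e f => wf k e && wf k f
  | k, fold _ _ e => wf (k + 1) e

/-- The term reads from the array. -/
def reads (a : ℕ) : Term → Bool
  | lit _ => false
  | size _ => false
  | var _ => false
  | cell a' e => a' == a || reads a e
  | bin _ e f => reads a e || reads a f
  | fold _ _ e => reads a e

/-- The term consists of constants, size parameters, variables of level less than `k`, and binary
operations. -/
def simple (k : ℕ) : Term → Bool
  | lit _ => true
  | size _ => true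
  | var m => m < k
  | cell _ _ => false
  | bin _ e f => simple k e && simple k f
  | fold _ _ _ => false

/-- The word length needed for the evaluation, relative to the length of the data. -/
def width : Term → ℕ
  | lit c => c + 1
  | size _ => 1
  | var _ => 1
  | cell _ e => width e + 1
  | bin _ e f => width e + width f
  | fold _ _ e => width e + 2

/-- A bound for the time needed for the evaluation. -/
def cost (sz : Fin 3 → ℕ) : Term → ℕ
  | lit _ => 2
  | size _ => 2
  | var _ => 2
  | cell _ e => cost sz e + 3
  | bin _ e f => cost sz e + cost sz f + 4
  | fold _ n e => sz n * (cost sz e + 16) + 8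

/-- The program that computes the value of a term in the scratch register `d`. -/
def comp : ℕ → ℕ → Term → Program
  | _, d, lit c => .assign (tmpReg d) (.lit c)
  | _, d, size i => .assign (tmpReg d) (.reg (szReg i))
  | _, d, var m => .assign (tmpReg d) (.reg (varReg m))
  | k, d, cell a e => .seq (comp k d e) (.assign (tmpReg d) (.cell a (.reg (tmpReg d))))
  | k, d, bin o e f => .seq (comp k d e) (.seq (comp k (d + 1) f)
      (.assign (tmpReg d) (o.expr (.reg (tmpReg d)) (.reg (tmpReg (d + 1))))))
  | k, d, fold b n e => .seq (.assign (tmpReg d) (.lit 0)) (forLoop k n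
      (.seq (comp (k + 1) (d + 1) e) (.assign (tmpReg d) (.plus (.reg (tmpReg d))
        (.minus (.reg (tmpReg (d + 1))) (.times (.lit b.toNat) (.reg (tmpReg d))))))))

end Term

/-- The registers that hold size parameters, counters of level less than `k`, and scratch values of
level less than `d`. -/
def Prot (k d r : ℕ) : Prop :=
  r < 4 ∨ r % 2 = 0 ∧ r < 2 * k + 4 ∨ r % 2 = 1 ∧ r < 2 * d + 5

/-- The registers hold the size parameters and the counters of level less than `k`. -/
def Agree (k : ℕ) (sz : Fin 3 → ℕ) (v : ℕ → ℕ) (s : Store) : Prop :=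
  (∀ i, s.reg (szReg i) = sz i) ∧ ∀ m < k, s.reg (varReg m) = v m

/-- Register layout: `0` for the answer, `1` to `3` for the sizes, even numbers from `4` for
counters, odd numbers from `5` for scratch values. All freshness facts are therefore parity
arithmetic. -/
theorem prot_szReg (k d : ℕ) (i : Fin 3) : Prot k d (szReg i) := by
  unfold Prot szReg
  omega

theorem prot_varReg {k m : ℕ} (d : ℕ) (h : m < k) : Prot k d (varReg m) := by
  unfold Prot varReg
  omega

theorem prot_tmpReg {d m : ℕ} (k : ℕ) (h : m < d) : Prot k d (tmpReg m) := by
  unfold Prot tmpReg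
  omega

theorem Prot.mono {k d k' d' r : ℕ} (h : Prot k d r) (hk : k ≤ k') (hd : d ≤ d') :
    Prot k' d' r := by
  unfold Prot at *
  omega

theorem Prot.ne_varReg {k d r : ℕ} (h : Prot k d r) : r ≠ varReg k := by
  unfold Prot varReg at *
  omega

theorem Prot.ne_tmpReg {k d r : ℕ} (h : Prot k d r) : r ≠ tmpReg d := by
  unfold Prot tmpReg at *
  omega

theorem Agree.of_prot {k d : ℕ} {sz : Fin 3 → ℕ} {v : ℕ → ℕ} {s s' : Store}
    (h : Agree k sz v s) (hs : ∀ r, Prot k d r → s'.reg r = s.reg r) : Agree k sz v s' :=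
  ⟨fun i => (hs _ (prot_szReg k d i)).trans (h.1 i),
    fun m hm => (hs _ (prot_varReg d hm)).trans (h.2 m hm)⟩

theorem Agree.update {k i : ℕ} {sz : Fin 3 → ℕ} {v : ℕ → ℕ} {s : Store}
    (h : Agree k sz v s) (hi : s.reg (varReg k) = i) :
    Agree (k + 1) sz (Function.update v k i) s := by
  refine ⟨h.1, fun m hm => ?_⟩
  rcases Nat.lt_succ_iff_lt_or_eq.1 hm with h' | rfl
  · rw [Function.update_of_ne h'.ne, h.2 m h']
  · rw [Function.update_self, hi]

theorem Agree.of_update {k i : ℕ} {sz : Fin 3 → ℕ} {v : ℕ → ℕ} {s : Store}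
    (h : Agree (k + 1) sz (Function.update v k i) s) : Agree k sz v s ∧ s.reg (varReg k) = i := by
  refine ⟨⟨h.1, fun m hm => ?_⟩, ?_⟩
  · rw [h.2 m (by omega), Function.update_of_ne hm.ne]
  · rw [h.2 k k.lt_succ_self, Function.update_self]

theorem Agree.setReg {k r x : ℕ} {sz : Fin 3 → ℕ} {v : ℕ → ℕ} {s : Store}
    (h : Agree k sz v s) (hr : r = varReg k) : Agree k sz v (s.setReg r x) := by
  subst hr
  refine h.of_prot (d := 0) fun r hr => ?_
  exact Function.update_of_ne hr.ne_varReg _ _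

@[simp] theorem Store.setReg_arr (s : Store) (r x : ℕ) : (s.setReg r x).arr = s.arr := rfl

@[simp] theorem Store.setReg_reg_self (s : Store) (r x : ℕ) : (s.setReg r x).reg r = x :=
  Function.update_self _ _ _

theorem Store.setReg_reg_of_ne (s : Store) {r r' : ℕ} (x : ℕ) (h : r' ≠ r) :
    (s.setReg r x).reg r' = s.reg r' :=
  Function.update_of_ne h _ _

/-- The constants: the test and the increment cost 4 each per iteration, the initialization 2, and
the last test 4. -/
theorem exec_forLoop {W k N c : ℕ} {n : Fin 3} {p : Program} {I : ℕ → Store → Prop} (hW : N < W)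
    (hW' : 1 < W) (hN : ∀ i s, I i s → s.reg (szReg n) = N)
    (hp : ∀ i < N, ∀ s, I i s → s.reg (varReg k) = i → ∃ m s', Exec W p s m s' ∧ m ≤ c ∧
      s'.reg (varReg k) = i ∧ I (i + 1) (s'.setReg (varReg k) (i + 1)))
    (s : Store) (h0 : I 0 (s.setReg (varReg k) 0)) :
    ∃ m s', Exec W (forLoop k n p) s m s' ∧ m ≤ N * (c + 8) + 6 ∧ I N s' := by
  -- Induction on the number of remaining iterations, because an execution of a loop is decomposed
  -- at its first iteration.
  suffices h : ∀ j ≤ N, ∀ s, I (N - j) s → s.reg (varReg k) = N - j →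
      ∃ m s', Exec W (.loop (.less (.reg (varReg k)) (.reg (szReg n)))
        (.seq p (.assign (varReg k) (.plus (.reg (varReg k)) (.lit 1))))) s m s' ∧
        m ≤ j * (c + 8) + 4 ∧ I N s' by
    obtain ⟨m, s', h1, h2, h3⟩ := h N le_rfl _ (by simpa using h0) (by simp)
    refine ⟨_, s', .seq (.assign (by simp [Expr.Fits]; omega)) h1, ?_, h3⟩
    simp only [Expr.cost]
    omega
  intro j
  induction j with
  | zero =>
    intro _ s hI hr
    rw [Nat.sub_zero] at hI hr
    have hn := hN _ _ hI
    refine ⟨_, s, .loopFalse ⟨?_, ?_, hW'⟩ ?_, ?_, hI⟩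
    · simpa [Expr.Fits, hr] using hW
    · simpa [Expr.Fits, hn] using hW
    · simp [Expr.eval, hr, hn]
    · simp [Expr.cost]
  | succ j ih =>
    intro hj s hI hr
    have hn := hN _ _ hI
    obtain ⟨m, s', h1, h2, h3, h4⟩ := hp _ (by omega) s hI hr
    have hs : N - (j + 1) + 1 = N - j := by omega
    rw [hs] at h4
    obtain ⟨m', s'', h5, h6, h7⟩ := ih (by omega) _ h4 (by simp)
    refine ⟨_, s'', .loopTrue (n := m') ⟨?_, ?_, hW'⟩ ?_ (.seq h1 (.assign ⟨?_, hW', ?_⟩)) ?_, ?_,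
      h7⟩
    · simp only [Expr.Fits, hr]; omega
    · simpa [Expr.Fits, hn] using hW
    · simp only [Expr.eval, hr, hn]
      rw [if_pos (by omega)]
      exact one_ne_zero
    · simp only [Expr.Fits, h3]; omega
    · simp only [Expr.eval, h3]; omega
    · simpa only [Expr.eval, h3, hs] using h5
    · simp only [Expr.cost]
      rw [Nat.succ_mul]
      omega

theorem two_le_pow_width {K : ℕ} (hK : 2 ≤ K) (e : Term) : 2 ≤ K ^ e.width := by
  have : 1 ≤ e.width := by induction e <;> simp only [Term.width] <;> omega
  calc 2 ≤ K := hK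
    _ = K ^ 1 := (pow_one K).symm
    _ ≤ _ := Nat.pow_le_pow_right (by omega) this

theorem mul_add_le_pow {a b : ℕ} (ha : 2 ≤ a) (hb : 2 ≤ b) : a + b ≤ a * b := by nlinarith

/-- Since both bounds are at least 2, their product also dominates their sum, so one bound serves
all operations. -/
theorem Op.eval_lt {o : Op} {a b p q : ℕ} (ha : a < p) (hb : b < q) (hp : 2 ≤ p) (hq : 2 ≤ q) :
    o.eval a b < p * q := by
  have h1 : p + q ≤ p * q := mul_add_le_pow hp hq
  cases o <;> simp only [Op.eval]
  · omega
  · omega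
  · exact Nat.mul_lt_mul'' ha hb
  · split_ifs <;> omega
  · split_ifs <;> omega

/-- The exponent depends on the syntax only, so word length is bounded uniformly over all inputs. A
bounded sum or maximum costs at most one factor `K`, as it has fewer than `K` summands. -/
theorem Term.val_lt {K : ℕ} {sz : Fin 3 → ℕ} {A : ℕ → ℕ → ℕ} (hK : 2 ≤ K) (hsz : ∀ i, sz i < K)
    (hA : ∀ a i, A a i < K) (e : Term) : ∀ k v, e.wf k → (∀ m < k, v m < K) →
      e.val sz A k v < K ^ e.width := by
  induction e with
  | lit c =>
    intro k v _ _
    exact (Nat.lt_pow_self (by omega)).trans_le (Nat.pow_le_pow_right (by omega) c.le_succ)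
  | size i => intro k v _ _; simpa [val, width] using hsz i
  | var m => intro k v h hv; simpa [val, width] using hv m (by simpa [wf] using h)
  | cell a e ih =>
    intro k v h hv
    calc _ < K ^ 1 := by simpa [val] using hA a _
      _ ≤ _ := Nat.pow_le_pow_right (by omega) (Nat.le_add_left _ _)
  | bin o e f ihe ihf =>
    intro k v h hv
    simp only [wf, Bool.and_eq_true] at h
    rw [width, pow_add]
    exact Op.eval_lt (ihe k v h.1 hv) (ihf k v h.2 hv) (two_le_pow_width hK e)
      (two_le_pow_width hK f)
  | fold b n e ih =>
    intro k v h hv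
    have hb : ∀ j < sz n, e.val sz A (k + 1) (Function.update v k j) ≤ K ^ e.width := by
      intro j hj
      refine (ih _ _ h fun m hm => ?_).le
      rcases Nat.lt_succ_iff_lt_or_eq.1 hm with h' | rfl
      · rw [Function.update_of_ne h'.ne]; exact hv m h'
      · rw [Function.update_self]; exact hj.trans (hsz n)
    have h1 := two_le_pow_width hK e
    calc _ ≤ sz n * K ^ e.width := foldVal_le hb
      _ < K * K ^ e.width := Nat.mul_lt_mul_of_pos_right (hsz n) (by omega)
      _ = K ^ (e.width + 1) := (pow_succ' _ _).symm
      _ ≤ _ := Nat.pow_le_pow_right (by omega) (by simp [width])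

theorem Term.val_congr {sz : Fin 3 → ℕ} {A A' : ℕ → ℕ → ℕ} (e : Term) :
    ∀ k v, (∀ a, e.reads a → A' a = A a) → e.val sz A' k v = e.val sz A k v := by
  induction e with
  | lit | size | var => intros; rfl
  | cell a e ih =>
    intro k v h
    simp only [val, ih k v fun a' ha' => h a' (by simp [reads, ha']), h a (by simp [reads])]
  | bin o e f ihe ihf =>
    intro k v h
    simp only [val, ihe k v fun a' ha' => h a' (by simp [reads, ha']),
      ihf k v fun a' ha' => h a' (by simp [reads, ha'])]
  | fold b n e ih =>
    intro k v h
    exact foldVal_congr fun i _ => ih _ _ h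

theorem Term.val_congr_of_ne {sz : Fin 3 → ℕ} {A A' : ℕ → ℕ → ℕ} {e : Term} {a : ℕ}
    (he : e.reads a = false) (h : ∀ a', a' ≠ a → A' a' = A a') (k : ℕ) (v : ℕ → ℕ) :
    e.val sz A' k v = e.val sz A k v :=
  e.val_congr k v fun a' ha' => h a' fun h' => by simp [h', he] at ha'

theorem Term.wf_of_simple {k k' : ℕ} {e : Term} (h : e.simple k) (hk : k ≤ k') : e.wf k' := by
  induction e with
  | lit | size => rfl
  | var m => simp [simple, wf] at *; omega
  | cell | fold => simp [simple] at h
  | bin o e f ihe ihf =>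
    simp only [simple, wf, Bool.and_eq_true] at *
    exact ⟨ihe h.1, ihf h.2⟩

theorem Term.simple_mono {k k' : ℕ} {e : Term} (h : e.simple k) (hk : k ≤ k') : e.simple k' := by
  induction e with
  | lit | size => rfl
  | var m => simp [simple] at *; omega
  | cell | fold => simp [simple] at h
  | bin o e f ihe ihf =>
    simp only [simple, Bool.and_eq_true] at *
    exact ⟨ihe h.1, ihf h.2⟩

theorem Term.val_of_simple {sz : Fin 3 → ℕ} {A A' : ℕ → ℕ → ℕ} {k k' : ℕ} {v v' : ℕ → ℕ}
    {e : Term} (h : e.simple k) (hv : ∀ m < k, v' m = v m) :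
    e.val sz A' k' v' = e.val sz A k v := by
  induction e with
  | lit | size => rfl
  | var m => exact hv m (by simpa [simple] using h)
  | cell | fold => simp [simple] at h
  | bin o e f ihe ihf =>
    simp only [simple, Bool.and_eq_true] at h
    simp only [val, ihe h.1, ihf h.2]

/-- The scratch registers form an evaluation stack: a subterm at depth `d` leaves the scratch values
below `d` and the counters below `k` intact, so a left operand survives the evaluation of the right
one at depth `d + 1`. -/
theorem exec_comp {W K : ℕ} {sz : Fin 3 → ℕ} (hK : 2 ≤ K) (hsz : ∀ i, sz i < K) (e : Term) :
    ∀ k d v s, e.wf k → (∀ m < k, v m < K) → Agree k sz v s → (∀ a i, s.arr a i < K) →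
      K ^ e.width ≤ W → ∃ n s', Exec W (e.comp k d) s n s' ∧ n ≤ e.cost sz ∧ s'.arr = s.arr ∧
        (∀ r, Prot k d r → s'.reg r = s.reg r) ∧ s'.reg (tmpReg d) = e.val sz s.arr k v := by
  induction e with
  | lit c =>
    intro k d v s h hv hs hA hW
    refine ⟨_, _, .assign ?_, le_rfl, rfl, fun r hr => ?_, ?_⟩
    · exact (Term.val_lt hK hsz hA (.lit c) k v h hv).trans_le hW
    · exact Store.setReg_reg_of_ne _ _ hr.ne_tmpReg
    · simp [Expr.eval, Term.val]
  | size i =>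
    intro k d v s h hv hs hA hW
    refine ⟨_, _, .assign ?_, le_rfl, rfl, fun r hr => ?_, ?_⟩
    · have := (Term.val_lt hK hsz hA (.size i) k v h hv).trans_le hW
      simpa [Expr.Fits, hs.1 i, Term.val] using this
    · exact Store.setReg_reg_of_ne _ _ hr.ne_tmpReg
    · simp [Expr.eval, Term.val, hs.1 i]
  | var m =>
    intro k d v s h hv hs hA hW
    have hm := hs.2 m (by simpa [Term.wf] using h)
    refine ⟨_, _, .assign ?_, le_rfl, rfl, fun r hr => ?_, ?_⟩
    · have := (Term.val_lt hK hsz hA (.var m) k v h hv).trans_le hW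
      simpa [Expr.Fits, hm, Term.val] using this
    · exact Store.setReg_reg_of_ne _ _ hr.ne_tmpReg
    · simp [Expr.eval, Term.val, hm]
  | cell a e ih =>
    intro k d v s h hv hs hA hW
    have hW1 : K ^ e.width ≤ W := le_trans (Nat.pow_le_pow_right (by omega) (Nat.le_succ _)) hW
    obtain ⟨n, s', h1, h2, h3, h4, h5⟩ := ih k d v s h hv hs hA hW1
    refine ⟨_, _, .seq h1 (.assign ⟨?_, ?_⟩), ?_, h3, fun r hr => ?_, ?_⟩
    · simpa [Expr.Fits, h5] using (Term.val_lt hK hsz hA e k v h hv).trans_le hW1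
    · rw [h3]
      refine (hA _ _).trans_le (le_trans ?_ hW)
      calc K = K ^ 1 := (pow_one K).symm
        _ ≤ _ := Nat.pow_le_pow_right (by omega) (by simp [Term.width])
    · simp only [Expr.cost, Term.cost]; omega
    · rw [Store.setReg_reg_of_ne _ _ hr.ne_tmpReg, h4 r hr]
    · simp [Expr.eval, Term.val, h3, h5]
  | bin o e f ihe ihf =>
    intro k d v s h hv hs hA hW
    have h' := h
    simp only [Term.wf, Bool.and_eq_true] at h
    have hWe : K ^ e.width ≤ W :=
      le_trans (Nat.pow_le_pow_right (by omega) (Nat.le_add_right _ _)) hW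
    have hWf : K ^ f.width ≤ W :=
      le_trans (Nat.pow_le_pow_right (by omega) (Nat.le_add_left _ _)) hW
    obtain ⟨n, s', h1, h2, h3, h4, h5⟩ := ihe k d v s h.1 hv hs hA hWe
    obtain ⟨n', s'', g1, g2, g3, g4, g5⟩ := ihf k (d + 1) v s' h.2 hv (hs.of_prot h4)
      (by rwa [h3]) hWf
    have hr1 : s''.reg (tmpReg d) = e.val sz s.arr k v := by
      rw [g4 _ (prot_tmpReg _ d.lt_succ_self), h5]
    have hr2 : s''.reg (tmpReg (d + 1)) = f.val sz s.arr k v := by rw [g5, h3]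
    have hve := (Term.val_lt hK hsz hA e k v h.1 hv).trans_le hWe
    have hvf := (Term.val_lt hK hsz hA f k v h.2 hv).trans_le hWf
    have hvo := (Term.val_lt hK hsz hA (.bin o e f) k v h' hv).trans_le hW
    have hW1 : 1 < W := lt_of_lt_of_le (two_le_pow_width hK _) hWe
    have hE : (o.expr (.reg (tmpReg d)) (.reg (tmpReg (d + 1)))).eval s'' =
        (Term.bin o e f).val sz s.arr k v := by
      cases o <;> simp [Op.expr, Expr.eval, hr1, hr2, Term.val, Op.eval]
    have hF : (o.expr (.reg (tmpReg d)) (.reg (tmpReg (d + 1)))).Fits W s'' := by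
      cases o <;> simp only [Op.expr, Expr.Fits, Expr.eval, hr1, hr2] <;>
        simp only [Term.val, Op.eval] at hvo <;>
        first | exact ⟨hve, hvf, hvo⟩ | exact ⟨hve, hvf⟩ | exact ⟨hve, hvf, hW1⟩
    refine ⟨_, _, .seq h1 (.seq g1 (.assign hF)), ?_, g3.trans h3, fun r hr => ?_, ?_⟩
    · cases o <;> simp only [Op.expr, Expr.cost, Term.cost] <;> omega
    · rw [Store.setReg_reg_of_ne _ _ hr.ne_tmpReg, g4 r (hr.mono le_rfl d.le_succ), h4 r hr]
    · rw [Store.setReg_reg_self, hE]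
  | fold b n e ih =>
    intro k d v s h hv hs hA hW
    have hWe : K ^ e.width ≤ W :=
      le_trans (Nat.pow_le_pow_right (by omega) (Nat.le_add_right _ _)) hW
    have hW1 : 1 < W := lt_of_lt_of_le (two_le_pow_width hK _) hWe
    have hKW : K ^ (e.width + 1) ≤ W :=
      le_trans (Nat.pow_le_pow_right (by omega) (by simp [Term.width])) hW
    have hnW : sz n < W := (hsz n).trans_le (le_trans (by
      calc K = K ^ 1 := (pow_one K).symm
        _ ≤ _ := Nat.pow_le_pow_right (by omega) (by simp)) hKW)
    let f : ℕ → ℕ := fun j => e.val sz s.arr (k + 1) (Function.update v k j)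
    have hv' : ∀ j < sz n, ∀ m < k + 1, Function.update v k j m < K := by
      intro j hj m hm
      rcases Nat.lt_succ_iff_lt_or_eq.1 hm with h' | rfl
      · rw [Function.update_of_ne h'.ne]; exact hv m h'
      · rw [Function.update_self]; exact hj.trans (hsz n)
    have hf : ∀ j < sz n, f j < K ^ e.width := fun j hj =>
      Term.val_lt hK hsz hA e _ _ h (hv' j hj)
    have hfold : ∀ j ≤ sz n, foldVal b f j < W := fun j hj => by
      have h1 := two_le_pow_width hK e
      calc _ ≤ j * K ^ e.width := foldVal_le fun i hi => (hf i (by omega)).le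
        _ ≤ sz n * K ^ e.width := Nat.mul_le_mul_right _ hj
        _ < K * K ^ e.width := Nat.mul_lt_mul_of_pos_right (hsz n) (by omega)
        _ = K ^ (e.width + 1) := (pow_succ' _ _).symm
        _ ≤ _ := hKW
    let I : ℕ → Store → Prop := fun i s' => s'.arr = s.arr ∧
      (∀ r, Prot k d r → s'.reg r = s.reg r) ∧ s'.reg (tmpReg d) = foldVal b f i
    have hvt : tmpReg d ≠ varReg k := by unfold tmpReg varReg; omega
    obtain ⟨m, s', h1, h2, h3, h4, h5⟩ := exec_forLoop (W := W) (k := k) (N := sz n)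
      (c := e.cost sz + 8) (n := n) (I := I)
      (p := .seq (e.comp (k + 1) (d + 1)) (.assign (tmpReg d) (.plus (.reg (tmpReg d))
        (.minus (.reg (tmpReg (d + 1))) (.times (.lit b.toNat) (.reg (tmpReg d))))))) hnW hW1
      (fun i s' hI => (hI.2.1 _ (prot_szReg k d n)).trans (hs.1 n))
      (by
        intro i hi s' hI hr
        obtain ⟨hI1, hI2, hI3⟩ := hI
        obtain ⟨m, s'', h1, h2, h3, h4, h5⟩ := ih (k + 1) (d + 1) (Function.update v k i) s' h
          (hv' i hi) ((hs.of_prot hI2).update hr) (by rwa [hI1]) hWe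
        have h6 : s''.reg (tmpReg d) = foldVal b f i := by
          rw [h4 _ (prot_tmpReg _ d.lt_succ_self), hI3]
        have h7 : s''.reg (tmpReg (d + 1)) = f i := by rw [h5, hI1]
        have h8 := hfold i hi.le
        have h9 := hfold (i + 1) hi
        have h10 := (hf i hi).trans_le hWe
        have h11 : b.toNat * foldVal b f i < W := by cases b <;> simp <;> omega
        have h12 : b.toNat < W := by cases b <;> simp <;> omega
        refine ⟨_, _, .seq h1 (.assign ?_), ?_, ?_, ?_, fun r hr => ?_, ?_⟩
        · simp only [Expr.Fits, Expr.eval, h6, h7]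
          exact ⟨h8, ⟨h10, h12, h8, h11⟩, h9⟩
        · simp only [Expr.cost]; omega
        · rw [Store.setReg_reg_of_ne _ _ hvt.symm, h4 _ (prot_varReg _ k.lt_succ_self), hr]
        · simp only [Store.setReg_arr, h3, hI1]
        · rw [Store.setReg_reg_of_ne _ _ hr.ne_varReg, Store.setReg_reg_of_ne _ _ hr.ne_tmpReg,
            h4 r (hr.mono k.le_succ d.le_succ), hI2 r hr]
        · rw [Store.setReg_reg_of_ne _ _ hvt, Store.setReg_reg_self]
          simp only [Expr.eval, h6, h7, foldVal])
      (s.setReg (tmpReg d) 0)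
      (by
        refine ⟨rfl, fun r hr => ?_, ?_⟩
        · rw [Store.setReg_reg_of_ne _ _ hr.ne_varReg, Store.setReg_reg_of_ne _ _ hr.ne_tmpReg]
        · rw [Store.setReg_reg_of_ne _ _ hvt, Store.setReg_reg_self]
          rfl)
    refine ⟨_, s', .seq (.assign (by simp [Expr.Fits]; omega)) h1, ?_, h3, h4, h5⟩
    simp only [Expr.cost, Term.cost]
    have h2 : m ≤ sz n * (e.cost sz + 16) + 6 := h2
    omega

/-! ### Programs as transformations of the arrays -/

/-- With the given size parameters and counters of level less than `k`, the program `p`, started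
with arrays `A`, halts within time `c`, with arrays that satisfy `Q`. -/
def Does (W : ℕ) (sz : Fin 3 → ℕ) (k : ℕ) (v : ℕ → ℕ) (p : Program) (c : ℕ) (A : ℕ → ℕ → ℕ)
    (Q : (ℕ → ℕ → ℕ) → Prop) : Prop :=
  ∀ s : Store, Agree k sz v s → s.arr = A →
    ∃ n s', Exec W p s n s' ∧ n ≤ c ∧ Agree k sz v s' ∧ Q s'.arr

section Does

variable {W K k c c' : ℕ} {sz : Fin 3 → ℕ} {v : ℕ → ℕ} {p q : Program} {A : ℕ → ℕ → ℕ}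
  {Q R : (ℕ → ℕ → ℕ) → Prop}

theorem Does.seq (hp : Does W sz k v p c A Q) (hq : ∀ A', Q A' → Does W sz k v q c' A' R) :
    Does W sz k v (.seq p q) (c + c') A R := by
  intro s hs hA
  obtain ⟨n, s', h1, h2, h3, h4⟩ := hp s hs hA
  obtain ⟨n', s'', g1, g2, g3, g4⟩ := hq _ h4 s' h3 rfl
  exact ⟨_, s'', .seq h1 g1, by omega, g3, g4⟩

theorem Does.mono (hp : Does W sz k v p c A Q) (hQ : ∀ A', Q A' → R A') :
    Does W sz k v p c A R := by
  intro s hs hA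
  obtain ⟨n, s', h1, h2, h3, h4⟩ := hp s hs hA
  exact ⟨n, s', h1, h2, h3, hQ _ h4⟩

theorem Does.forLoop {n : Fin 3} {I : ℕ → (ℕ → ℕ → ℕ) → Prop} (hW : sz n < W) (hW' : 1 < W)
    (hp : ∀ i < sz n, ∀ A, I i A → Does W sz (k + 1) (Function.update v k i) p c A (I (i + 1)))
    (h0 : I 0 A) : Does W sz k v (forLoop k n p) (sz n * (c + 8) + 6) A (I (sz n)) := by
  intro s hs hA
  obtain ⟨m, s', h1, h2, h3, h4⟩ := exec_forLoop (W := W) (k := k) (N := sz n) (c := c) (n := n)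
    (p := p) (I := fun i s => Agree k sz v s ∧ I i s.arr) hW hW' (fun i s hI => hI.1.1 n)
    (fun i hi s hI hr => by
      obtain ⟨m, s', h1, h2, h3, h4⟩ := hp i hi _ hI.2 s (hI.1.update hr) rfl
      obtain ⟨h5, h6⟩ := h3.of_update
      exact ⟨m, s', h1, h2, h6, h5.setReg rfl, h4⟩)
    s ⟨hs.setReg rfl, by subst hA; exact h0⟩
  exact ⟨m, s', h1, h2, h3, h4⟩

/-- Fill a multidimensional array with the values of the term `e`, starting from the address
given by `b`. -/
def tab (a : ℕ) (e : Term) : ℕ → Term → List (Fin 3) → Program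
  | k, b, [] => .seq (b.comp k 0) (.seq (e.comp k 1) (.store a (.reg (tmpReg 0)) (.reg (tmpReg 1))))
  | k, b, n :: ns => forLoop k n
      (tab a e (k + 1) (.bin .plus (.bin .times b (.size n)) (.var k)) ns)

/-- A bound for the time needed to fill an array. -/
def tabCost (sz : Fin 3 → ℕ) (e : Term) : Term → List (Fin 3) → ℕ
  | b, [] => b.cost sz + e.cost sz + 3
  | b, n :: ns =>
    sz n * (tabCost sz e (.bin .plus (.bin .times b (.size n)) (.var 0)) ns + 8) + 6

/-- `P k v i` holds for all indices of a multidimensional array, where `v` contains the coordinates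
from level `k` on, and `i` is the address. -/
def ForallIdx (sz : Fin 3 → ℕ) (P : ℕ → (ℕ → ℕ) → ℕ → Prop) :
    ℕ → (ℕ → ℕ) → ℕ → List (Fin 3) → Prop
  | k, v, i, [] => P k v i
  | k, v, i, n :: ns => ∀ j < sz n, ForallIdx sz P (k + 1) (Function.update v k j) (i * sz n + j) ns

/-- The implication is needed only at addresses of the block with number `i`; this makes facts about
one block stable under writes to another. -/
theorem ForallIdx.mono {P P' : ℕ → (ℕ → ℕ) → ℕ → Prop} (ns : List (Fin 3)) :
    ∀ {k v i}, (∀ k v j, i * (ns.map sz).prod ≤ j → j < (i + 1) * (ns.map sz).prod →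
      P k v j → P' k v j) → ForallIdx sz P k v i ns → ForallIdx sz P' k v i ns := by
  induction ns with
  | nil => intro k v i h h'; exact h _ _ _ (by simp) (by simp) h'
  | cons n ns ih =>
    intro k v i h h' j hj
    refine ih (fun k' v' j' h1 h2 => ?_) (h' j hj)
    refine h _ _ _ ?_ ?_
    · refine le_trans ?_ h1
      rw [List.map_cons, List.prod_cons, ← mul_assoc]
      exact Nat.mul_le_mul_right _ (Nat.le_add_right _ _)
    · refine lt_of_lt_of_le h2 ?_
      rw [List.map_cons, List.prod_cons, ← mul_assoc]
      refine Nat.mul_le_mul_right _ ?_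
      rw [Nat.succ_mul]
      omega

/-- All variables cost the same, so `tabCost` may use `.var 0` in place of the actual loop counter.
-/
theorem tabCost_congr {e : Term} (ns : List (Fin 3)) :
    ∀ {b b' : Term}, b.cost sz = b'.cost sz → tabCost sz e b ns = tabCost sz e b' ns := by
  induction ns with
  | nil => intro b b' h; simp only [tabCost, h]
  | cons n ns ih =>
    intro b b' h
    simp only [tabCost]
    rw [ih]
    simp only [Term.cost, h]

/-- As `e` does not read `a`, its values do not change while `a` is being filled. The values stored
must be below `K` itself, not merely below `K ^ e.width`; thus the data bound survives each stage
and widths do not accumulate. -/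
theorem does_tab {a : ℕ} {e : Term} (hK : 2 ≤ K) (hsz : ∀ i, sz i < K) (he : e.reads a = false)
    (hWe : K ^ e.width ≤ W) (ns : List (Fin 3)) :
    ∀ {k v A} (b : Term), (∀ m < k, v m < K) → (∀ a i, A a i < K) → b.simple k →
      e.wf (k + ns.length) → K ^ (b.width + 2 * ns.length) ≤ W →
      ForallIdx sz (fun k v _ => e.val sz A k v < K) k v (b.val sz A k v) ns →
      Does W sz k v (tab a e k b ns) (tabCost sz e b ns) A fun A' =>
        (∀ a', a' ≠ a → A' a' = A a') ∧ (∀ a i, A' a i < K) ∧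
        (∀ i, ¬ (b.val sz A k v * (ns.map sz).prod ≤ i ∧
          i < (b.val sz A k v + 1) * (ns.map sz).prod) → A' a i = A a i) ∧
        ForallIdx sz (fun k v i => A' a i = e.val sz A k v) k v (b.val sz A k v) ns := by
  have hW1 : 1 < W := lt_of_lt_of_le (two_le_pow_width hK _) hWe
  induction ns with
  | nil =>
    intro k v A b hv hA hb hwf hWb hlt s hs hsA
    subst hsA
    obtain ⟨n, s', h1, h2, h3, h4, h5⟩ := exec_comp hK hsz b k 0 v s (Term.wf_of_simple hb le_rfl) hv hs hA
      (by simpa using hWb)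
    obtain ⟨n', s'', g1, g2, g3, g4, g5⟩ := exec_comp hK hsz e k 1 v s' (by simpa using hwf) hv
      (hs.of_prot h4) (by rwa [h3]) hWe
    have hb' : s''.reg (tmpReg 0) = b.val sz s.arr k v := by
      rw [g4 _ (prot_tmpReg _ one_pos), h5]
    have he' : s''.reg (tmpReg 1) = e.val sz s.arr k v := by rw [g5, h3]
    have hlt' : e.val sz s.arr k v < K := hlt
    refine ⟨_, _, .seq h1 (.seq g1 (.store ?_ ?_)), ?_, ?_, ?_, ?_, ?_, ?_⟩
    · rw [Expr.Fits, hb']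
      exact (Term.val_lt hK hsz hA b k v (Term.wf_of_simple hb le_rfl) hv).trans_le (by simpa using hWb)
    · rw [Expr.Fits, he']
      exact (Term.val_lt hK hsz hA e k v (by simpa using hwf) hv).trans_le hWe
    · simp only [Expr.cost, tabCost]; omega
    · have := (hs.of_prot h4).of_prot g4
      exact this
    · intro a' ha'
      simp only [Store.setArr, g3, h3, Function.update_of_ne ha']
    · intro a' i
      simp only [Store.setArr, g3, h3, Expr.eval, he', hb']
      rcases eq_or_ne a' a with rfl | ha
      · rw [Function.update_self]
        rcases eq_or_ne i (b.val sz s.arr k v) with rfl | hi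
        · rwa [Function.update_self]
        · rw [Function.update_of_ne hi]; exact hA _ _
      · rw [Function.update_of_ne ha]; exact hA _ _
    · intro i hi
      simp only [Store.setArr, g3, h3, Expr.eval, hb', Function.update_self]
      refine Function.update_of_ne ?_ _ _
      rintro rfl
      simp at hi
    · simp only [ForallIdx, Store.setArr, Expr.eval, hb', he', Function.update_self]
  | cons n ns ih =>
    intro k v A b hv hA hb hwf hWb hlt
    set B := b.val sz A k v with hB
    set V := (ns.map sz).prod with hV
    have hnW : sz n < W := (hsz n).trans_le (le_trans (by
      calc K = K ^ 1 := (pow_one K).symm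
        _ ≤ _ := Nat.pow_le_pow_right (by omega)
          (by simp only [List.length_cons]; omega)) hWb)
    let I : ℕ → (ℕ → ℕ → ℕ) → Prop := fun j A' =>
      (∀ a', a' ≠ a → A' a' = A a') ∧ (∀ a i, A' a i < K) ∧
      (∀ i, ¬ (B * sz n * V ≤ i ∧ i < (B * sz n + j) * V) → A' a i = A a i) ∧
      ∀ j' < j, ForallIdx sz (fun k v i => A' a i = e.val sz A k v) (k + 1)
        (Function.update v k j') (B * sz n + j') ns
    have key : Does W sz k v (tab a e k b (n :: ns)) (tabCost sz e b (n :: ns)) A (I (sz n)) := by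
      refine Does.forLoop (I := I) hnW hW1 (fun i hi A' hI => ?_)
        ⟨fun _ _ => rfl, hA, fun _ _ => rfl, fun j hj => absurd hj (Nat.not_lt_zero _)⟩
      obtain ⟨hI1, hI2, hI3, hI4⟩ := hI
      have hb' : (Term.bin .plus (.bin .times b (.size n)) (.var k)).val sz A' (k + 1)
          (Function.update v k i) = B * sz n + i := by
        simp only [Term.val, Op.eval, Function.update_self]
        rw [Term.val_of_simple (A := A) hb fun m hm => Function.update_of_ne hm.ne _ _]
      have hval := Term.val_congr_of_ne (sz := sz) he hI1
      have h := ih (k := k + 1) (v := Function.update v k i) (A := A')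
        (.bin .plus (.bin .times b (.size n)) (.var k))
        (by
          intro m hm
          rcases Nat.lt_succ_iff_lt_or_eq.1 hm with h' | rfl
          · rw [Function.update_of_ne h'.ne]; exact hv m h'
          · rw [Function.update_self]; exact hi.trans (hsz n))
        hI2 (by simp [Term.simple, Term.simple_mono hb k.le_succ])
        (by rwa [List.length_cons, ← add_assoc, add_right_comm] at hwf)
        (by
          refine le_trans (Nat.pow_le_pow_right (by omega) ?_) hWb
          simp only [Term.width, List.length_cons]
          omega)
        (by
          rw [hb']
          simp only [hval]
          exact hlt i hi)
      rw [hb'] at h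
      simp only [hval] at h
      have hcost : tabCost sz e (.bin .plus (.bin .times b (.size n)) (.var k)) ns =
          tabCost sz e (.bin .plus (.bin .times b (.size n)) (.var 0)) ns :=
        tabCost_congr _ rfl
      rw [hcost] at h
      refine h.mono fun A'' ⟨h1, h2, h3, h4⟩ => ⟨fun a' ha' => (h1 a' ha').trans (hI1 a' ha'), h2,
        fun j hj => ?_, fun j hj => ?_⟩
      · rw [h3, hI3]
        · intro h5
          exact hj ⟨h5.1, h5.2.trans_le (Nat.mul_le_mul_right _ (by omega))⟩
        · intro h5
          exact hj ⟨le_trans (Nat.mul_le_mul_right _ (by omega)) h5.1,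
            by rw [← add_assoc]; exact h5.2⟩
      · rcases Nat.lt_succ_iff_lt_or_eq.1 hj with h' | rfl
        · refine (hI4 j h').mono ns fun k' v' j' h5 h6 h7 => ?_
          rw [h3 j', h7]
          intro h8
          change j' < (B * sz n + j + 1) * V at h6
          -- The earlier block `j` ends before block `i`, the one just written, begins.
          have h9 : (B * sz n + j + 1) * V ≤ (B * sz n + i) * V :=
            Nat.mul_le_mul_right _ (by omega)
          omega
        · exact h4
    refine key.mono fun A' ⟨h1, h2, h3, h4⟩ => ⟨h1, h2, fun i hi => h3 i ?_, h4⟩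
    rw [List.map_cons, List.prod_cons] at hi
    rwa [← Nat.succ_mul, mul_assoc, mul_assoc] at *

end Does

end RAM

namespace RAM

/-! ## Saturation of a set of nodes -/

/-- The least set that contains every node `q` with at least `c q` predecessors in the set. -/
inductive Sat {V : Type*} (E : V → V → Prop) (c : V → ℕ) : V → Prop
  | mk {q : V} (s : Finset V) (hs : ∀ p ∈ s, Sat E c p) (hE : ∀ p ∈ s, E p q) (hc : c q ≤ s.card) :
      Sat E c q

section Fill

variable {W K k w : ℕ} {sz : Fin 3 → ℕ} {v : ℕ → ℕ} {A : ℕ → ℕ → ℕ}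

theorem Does.mono_cost {p : Program} {c c' : ℕ} {Q : (ℕ → ℕ → ℕ) → Prop}
    (h : Does W sz k v p c A Q) (hc : c ≤ c') : Does W sz k v p c' A Q := by
  intro s hs hA
  obtain ⟨n, s', h1, h2, h3, h4⟩ := h s hs hA
  exact ⟨n, s', h1, h2.trans hc, h3, h4⟩

/-- Charging each stage against a fixed total avoids carrying explicit sums of costs through long
compositions. -/
theorem Does.seq_budget {p q : Program} {c c₁ : ℕ} {Q R : (ℕ → ℕ → ℕ) → Prop}
    (hp : Does W sz k v p c₁ A Q) (hc : c₁ ≤ c)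
    (hq : ∀ A', Q A' → Does W sz k v q (c - c₁) A' R) : Does W sz k v (.seq p q) c A R :=
  (hp.seq hq).mono_cost (by omega)

/-- The postcondition of filling the array `a` with the values of `e`. -/
def Filled (K : ℕ) (sz : Fin 3 → ℕ) (a : ℕ) (e : Term) (k : ℕ) (v : ℕ → ℕ) (ns : List (Fin 3))
    (A A' : ℕ → ℕ → ℕ) : Prop :=
  (∀ a', a' ≠ a → A' a' = A a') ∧ (∀ a i, A' a i < K) ∧
    ForallIdx sz (fun k v i => A' a i = e.val sz A k v) k v 0 ns

theorem Does.fill (hK : 2 ≤ K) (hsz : ∀ i, sz i < K) (hW : K ^ w ≤ W) (hv : ∀ m < k, v m < K)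
    (hA : ∀ a i, A a i < K) (a : ℕ) (e : Term) (ns : List (Fin 3))
    (hwf : e.wf (k + ns.length) = true) (he : e.reads a = false) (hw : e.width ≤ w)
    (hns : 1 + 2 * ns.length ≤ w)
    (hlt : ForallIdx sz (fun k v _ => e.val sz A k v < K) k v 0 ns) :
    Does W sz k v (tab a e k (.lit 0) ns) (tabCost sz e (.lit 0) ns) A
      (Filled K sz a e k v ns A) :=
  (does_tab hK hsz he (le_trans (Nat.pow_le_pow_right (by omega) hw) hW) ns (.lit 0) hv hA rfl hwf
    (le_trans (Nat.pow_le_pow_right (by omega) hns) hW) hlt).mono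
    fun _ ⟨h1, h2, _, h4⟩ => ⟨h1, h2, h4⟩

end Fill

/-- One plus the number of a node that is not marked and has counter zero, and `0` if there is no
such node. -/
def pickTerm : Term :=
  .fold true 2 (.bin .times (.bin .plus (.var 1) (.lit 1))
    (.bin .times (.bin .equal (.cell 2 (.var 1)) (.lit 0))
      (.bin .equal (.cell 3 (.var 1)) (.lit 0))))

/-- Mark the node that has been picked. -/
def markTerm : Term :=
  .bin .plus (.cell 3 (.var 1)) (.bin .equal (.bin .plus (.var 1) (.lit 1)) (.cell 4 (.lit 0)))

/-- Decrement the counters of the successors of the node that has been picked. -/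
def decTerm : Term :=
  .bin .minus (.cell 2 (.var 1)) (.bin .times (.bin .less (.lit 0) (.cell 4 (.lit 0)))
    (.cell 1 (.bin .plus (.bin .times (.bin .minus (.cell 4 (.lit 0)) (.lit 1)) (.size 2))
      (.var 1))))

/-- One round of the saturation. -/
def satRound : Program :=
  .seq (tab 4 pickTerm 1 (.lit 0) []) <| .seq (tab 5 markTerm 1 (.lit 0) [2]) <|
  .seq (tab 3 (.cell 5 (.var 1)) 1 (.lit 0) [2]) <| .seq (tab 5 decTerm 1 (.lit 0) [2])
  (tab 2 (.cell 5 (.var 1)) 1 (.lit 0) [2])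

/-- Saturation: array `1` is the adjacency matrix, array `2` contains the thresholds, and array `3`
is the characteristic vector of the result. -/
def satProg : Program :=
  .seq (tab 3 (.lit 0) 0 (.lit 0) [2]) (forLoop 0 2 satRound)

/-- Adding one distinguishes node `0` from failure, and a nonzero maximum is attained at an eligible
node. -/
theorem sup_pick {N : ℕ} (P : ℕ → Prop) [DecidablePred P] :
    ((Finset.range N).sup (fun m => (m + 1) * if P m then 1 else 0) = 0 ∧ ∀ m < N, ¬ P m) ∨
    ∃ m < N, P m ∧ (Finset.range N).sup (fun m => (m + 1) * if P m then 1 else 0) = m + 1 := by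
  by_cases h : ∀ m < N, ¬ P m
  · left
    refine ⟨?_, h⟩
    rw [← Nat.bot_eq_zero, Finset.sup_eq_bot_iff]
    intro m hm
    simp [h m (Finset.mem_range.1 hm)]
  · right
    push Not at h
    obtain ⟨m, hm, hP⟩ := h
    obtain ⟨m', hm', h'⟩ := Finset.exists_mem_eq_sup (Finset.range N) ⟨m, Finset.mem_range.2 hm⟩
      (fun m => (m + 1) * if P m then 1 else 0)
    have h1 := Finset.le_sup (f := fun m => (m + 1) * if P m then 1 else 0) (Finset.mem_range.2 hm)
    rw [h'] at h1
    have hP' : P m' := by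
      by_contra hn
      simp [hP, hn] at h1
    exact ⟨m', Finset.mem_range.1 hm', hP', by simpa [hP'] using h'⟩

section Sat

variable {W K w : ℕ} {sz : Fin 3 → ℕ} {v : ℕ → ℕ} {A : ℕ → ℕ → ℕ}

/-- The postcondition of one round of the saturation. -/
def RoundPost (K N : ℕ) (A A' : ℕ → ℕ → ℕ) : Prop :=
  (∀ a, (a < 2 ∨ 5 < a) → A' a = A a) ∧ (∀ a i, A' a i < K) ∧
  ((∃ m < N, (A 2 m = 0 ∧ A 3 m = 0) ∧
      (∀ q < N, A' 3 q = A 3 q + if q = m then 1 else 0) ∧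
      (∀ q < N, A' 2 q = A 2 q - A 1 (m * N + q))) ∨
    ((∀ m < N, ¬ (A 2 m = 0 ∧ A 3 m = 0)) ∧ ∀ q < N, A' 3 q = A 3 q ∧ A' 2 q = A 2 q))

/-- Array `5` is a buffer, because a fill may not read its target. If no node is eligible, cell `0`
of array `4` holds `0`, and both updates change nothing. -/
theorem does_satRound (hK : 2 ≤ K) (hsz : ∀ i, sz i < K) (hW : K ^ w ≤ W) (hw : 30 ≤ w)
    (hv : v 0 < K) (hA : ∀ a i, A a i < K) (h3 : ∀ q < sz 2, A 3 q ≤ 1) :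
    Does W sz 1 v satRound (sz 2 * 300 + 300) A (RoundPost K (sz 2) A) := by
  have hv' : ∀ m < 1, v m < K := fun m hm => by rwa [Nat.lt_one_iff.1 hm]
  have hpick : ∀ A : ℕ → ℕ → ℕ, pickTerm.val sz A 1 v = (Finset.range (sz 2)).sup
      (fun m => (m + 1) * if A 2 m = 0 ∧ A 3 m = 0 then 1 else 0) := by
    intro A
    simp only [pickTerm, Term.val, foldVal_true]
    refine Finset.sup_congr rfl fun m _ => ?_
    by_cases h1 : A 2 m = 0 <;> by_cases h2 : A 3 m = 0 <;> simp [Op.eval, h1, h2]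
  have hP := sup_pick (N := sz 2) (fun m => A 2 m = 0 ∧ A 3 m = 0)
  set P := (Finset.range (sz 2)).sup
      (fun m => (m + 1) * if A 2 m = 0 ∧ A 3 m = 0 then 1 else 0) with hPdef
  have hPK : P < K := by
    have := hsz 2
    rcases hP with ⟨h, -⟩ | ⟨m, hm, -, h⟩ <;> omega
  · refine Does.seq_budget (Does.fill hK hsz hW hv' hA 4 pickTerm [] (by decide) (by decide)
      (le_trans (by decide) hw) (le_trans (by decide) hw) (by simpa only [ForallIdx, hpick])) ?_ ?_
    · simp only [tabCost, pickTerm, Term.cost]; omega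
    rintro A₁ ⟨f1, b1, g1⟩
    simp only [ForallIdx, hpick] at g1
    have e13 : A₁ 3 = A 3 := f1 3 (by decide)
    refine Does.seq_budget (Does.fill hK hsz hW hv' b1 5 markTerm [2] (by decide) (by decide)
      (le_trans (by decide) hw) (le_trans (by decide) hw) ?_) ?_ ?_
    · intro q hq
      simp only [ForallIdx, markTerm, Term.val, Op.eval, Function.update_self, e13, g1]
      have h4 := hsz 2
      have h5 := h3 q hq
      split_ifs with h6
      -- Only the picked node is incremented, and it was unmarked, so the new mark is `1 < K`.
      · rcases hP with ⟨h, -⟩ | ⟨m, hm, h7, h⟩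
        · omega
        · have : q = m := by omega
          subst this
          omega
      · omega
    · simp only [tabCost, pickTerm, markTerm, Term.cost]; omega
    rintro A₂ ⟨f2, b2, g2⟩
    simp only [ForallIdx, markTerm, Term.val, Op.eval, Function.update_self, e13, g1,
      zero_mul, zero_add] at g2
    refine Does.seq_budget (Does.fill hK hsz hW hv' b2 3 (.cell 5 (.var 1)) [2] (by decide) (by decide)
      (le_trans (by decide) hw) (le_trans (by decide) hw) ?_) ?_ ?_
    · intro q hq
      exact b2 _ _
    · simp only [tabCost, pickTerm, markTerm, Term.cost]; omega
    rintro A₃ ⟨f3, b3, g3⟩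
    simp only [ForallIdx, Term.val, Function.update_self, zero_mul, zero_add] at g3
    have e31 : A₃ 1 = A 1 := by rw [f3 1 (by decide), f2 1 (by decide), f1 1 (by decide)]
    have e32 : A₃ 2 = A 2 := by rw [f3 2 (by decide), f2 2 (by decide), f1 2 (by decide)]
    have e34 : A₃ 4 = A₁ 4 := by rw [f3 4 (by decide), f2 4 (by decide)]
    refine Does.seq_budget (Does.fill hK hsz hW hv' b3 5 decTerm [2] (by decide) (by decide)
      (le_trans (by decide) hw) (le_trans (by decide) hw) ?_) ?_ ?_
    · intro q hq
      simp only [ForallIdx, decTerm, Term.val, Op.eval, Function.update_self]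
      exact lt_of_le_of_lt (Nat.sub_le _ _) (b3 _ _)
    · simp only [tabCost, pickTerm, markTerm, decTerm, Term.cost]; omega
    rintro A₄ ⟨f4, b4, g4⟩
    simp only [ForallIdx, decTerm, Term.val, Op.eval, Function.update_self, zero_mul, zero_add,
      e31, e32, e34, g1] at g4
    refine ((Does.fill hK hsz hW hv' b4 2 (.cell 5 (.var 1)) [2] (by decide) (by decide)
      (le_trans (by decide) hw) (le_trans (by decide) hw) ?_).mono ?_).mono_cost ?_
    · intro q hq
      exact b4 _ _
    rintro A₅ ⟨f5, b5, g5⟩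
    simp only [ForallIdx, Term.val, Function.update_self, zero_mul, zero_add] at g5
    refine ⟨fun a ha => ?_, b5, ?_⟩
    · rw [f5 a (by omega), f4 a (by omega), f3 a (by omega), f2 a (by omega), f1 a (by omega)]
    · have h53 : ∀ q < sz 2, A₅ 3 q = A 3 q + if q + 1 = P then 1 else 0 := fun q hq => by
        rw [f5 3 (by decide), f4 3 (by decide), g3 q hq, g2 q hq]
      have h52 : ∀ q < sz 2, A₅ 2 q =
          A 2 q - (if 0 < P then 1 else 0) * A 1 ((P - 1) * sz 2 + q) := fun q hq => by
        rw [g5 q hq, g4 q hq]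
      rcases hP with ⟨h, hn⟩ | ⟨m, hm, h7, h⟩
      · right
        refine ⟨hn, fun q hq => ?_⟩
        rw [h53 q hq, h52 q hq, h]
        simp
      · left
        refine ⟨m, hm, h7, fun q hq => ?_, fun q hq => ?_⟩
        · rw [h53 q hq, h]
          simp
        · rw [h52 q hq, h]
          simp
    · simp only [tabCost, pickTerm, markTerm, decTerm, Term.cost]; omega

open Classical in
theorem does_sat {V : Type*} [Fintype V] (ix : V ≃ Fin (sz 2)) (E : V → V → Prop) (c : V → ℕ)
    (hK : 2 ≤ K) (hsz : ∀ i, sz i < K) (hW : K ^ w ≤ W) (hw : 30 ≤ w)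
    (hA : ∀ a i, A a i < K)
    (hE : ∀ p q, A 1 (ix p * sz 2 + ix q) = if E p q then 1 else 0) (hc : ∀ q, A 2 (ix q) = c q) :
    Does W sz 0 v satProg (sz 2 * (sz 2 * 300 + 400) + 100) A fun A' =>
      (∀ a, (a < 2 ∨ 5 < a) → A' a = A a) ∧ (∀ a i, A' a i < K) ∧
      ∀ q, A' 3 (ix q) = if Sat E c q then 1 else 0 := by
  have hW1 : K ≤ W := le_trans (by
    calc K = K ^ 1 := (pow_one K).symm
      _ ≤ _ := Nat.pow_le_pow_right (by omega) (by omega)) hW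
  have hall : ∀ {P : ℕ → Prop}, (∀ q, P (ix q)) ↔ ∀ q < sz 2, P q := fun {P} =>
    ⟨fun h q hq => by simpa using h (ix.symm ⟨q, hq⟩), fun h q => h _ (ix q).2⟩
  -- `D` is the set of marked nodes. Each counter is the threshold minus the number of marked
  -- predecessors, truncated at zero. After `j` rounds, at least `j` nodes are marked or no node is
  -- eligible any more.
  let I : ℕ → (ℕ → ℕ → ℕ) → Prop := fun j A' =>
    (∀ a, (a < 2 ∨ 5 < a) → A' a = A a) ∧ (∀ a i, A' a i < K) ∧ ∃ D : Finset V,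
      (∀ q ∈ D, Sat E c q) ∧ (∀ q, A' 3 (ix q) = if q ∈ D then 1 else 0) ∧
      (∀ q, A' 2 (ix q) = c q - (D.filter fun p => E p q).card) ∧
      (j ≤ D.card ∨ ∀ q, q ∉ D → A' 2 (ix q) ≠ 0)
  · refine Does.seq_budget (Does.fill hK hsz hW (fun m hm => absurd hm (Nat.not_lt_zero m)) hA
      3 (.lit 0) [2] rfl rfl (le_trans (by decide) hw) (le_trans (by decide) hw)
      (fun q hq => by simp only [ForallIdx, Term.val]; omega)) ?_ ?_
    · simp only [tabCost, Term.cost, Nat.mul_add]; omega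
    rintro A₁ ⟨f1, b1, g1⟩
    simp only [ForallIdx, Term.val, zero_mul, zero_add] at g1
    refine ((Does.forLoop (I := I) (c := sz 2 * 300 + 300) ((hsz 2).trans_le hW1) (by omega)
      ?_ ?_).mono ?_).mono_cost ?_
    · rintro j hj A' ⟨hf, hb, D, hD, h3, h2, hd⟩
      refine (does_satRound hK hsz hW hw (by simpa using hj.trans (hsz 2)) hb
        (hall.1 fun q => by rw [h3]; split_ifs <;> omega)).mono ?_
      rintro A'' ⟨hf', hb', h⟩
      refine ⟨fun a ha => (hf' a ha).trans (hf a ha), hb', ?_⟩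
      rcases h with ⟨m, hm, ⟨hm2, hm3⟩, g3, g2⟩ | ⟨hn, g⟩
      · obtain ⟨p, rfl⟩ : ∃ p, (ix p : ℕ) = m := ⟨ix.symm ⟨m, hm⟩, by simp⟩
        have hp : p ∉ D := fun hp => by simp [h3, hp] at hm3
        refine ⟨insert p D, fun q hq => ?_, fun q => ?_, fun q => ?_, ?_⟩
        · rcases Finset.mem_insert.1 hq with rfl | hq
          · refine Sat.mk (D.filter fun r => E r q) (fun r hr => hD r (Finset.mem_filter.1 hr).1)
              (fun r hr => (Finset.mem_filter.1 hr).2) ?_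
            rw [h2] at hm2
            omega
          · exact hD q hq
        · rw [g3 _ (ix q).2, h3]
          by_cases hq : q = p
          · subst hq; simp [hp]
          · have : (ix q : ℕ) ≠ ix p := fun h => hq (ix.injective (Fin.ext h))
            simp [hq, this]
        · rw [g2 _ (ix q).2, h2, hf 1 (by omega), hE, Finset.filter_insert]
          split_ifs with hEq
          · rw [Finset.card_insert_of_notMem (by simp [hp]), Nat.sub_sub]
          · rfl
        · rcases hd with hd | hd
          · left
            rw [Finset.card_insert_of_notMem hp]
            omega
          · exact absurd hm2 (hd p hp)
      · have h' : ∀ q, q ∉ D → A' 2 (ix q) ≠ 0 := fun q hq h0 =>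
          hn _ (ix q).2 ⟨h0, by simp [h3, hq]⟩
        refine ⟨D, hD, fun q => by rw [(g _ (ix q).2).1, h3], fun q => by rw [(g _ (ix q).2).2, h2],
          Or.inr fun q hq => ?_⟩
        rw [(g _ (ix q).2).2]
        exact h' q hq
    · refine ⟨fun a ha => f1 a (by omega), b1, ∅, by simp, fun q => ?_, fun q => ?_, Or.inl (by simp)⟩
      · simpa using g1 _ (ix q).2
      · simp [f1 2 (by decide), hc]
    · rintro A' ⟨hf, hb, D, hD, h3, h2, hd⟩
      refine ⟨hf, hb, fun q => ?_⟩
      have : Sat E c q ↔ q ∈ D := by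
        refine ⟨fun h => ?_, hD q⟩
        -- Either all nodes are marked, or the marked set is closed under the rule and so contains
        -- the least closed set.
        rcases hd with hd | hd
        · have hcard : D.card = Fintype.card V := by
            refine le_antisymm D.card_le_univ ?_
            rw [Fintype.card_congr ix, Fintype.card_fin]
            exact hd
          rw [Finset.card_eq_iff_eq_univ] at hcard
          simp [hcard]
        · induction h with
          | @mk q s hs hE' hc' ih =>
            by_contra hq
            refine hd q hq ?_
            rw [h2]
            have : s.card ≤ (D.filter fun p => E p q).card :=
              Finset.card_le_card fun p hp => Finset.mem_filter.2 ⟨ih p hp, hE' p hp⟩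
            omega
      rw [h3]
      simp [this]
    · simp only [tabCost, Term.cost, Nat.mul_add]; omega

end Sat

end RAM

/-! ### Reachability and unbounded path lengths as saturations -/

namespace RAM

/-- A path of length `k` leads from a node in `I` to the given node. -/
def PathN {V : Type*} (E : V → V → Prop) (I : V → Prop) : ℕ → V → Prop
  | 0, q => I q
  | k + 1, q => ∃ p, PathN E I k p ∧ E p q

section

variable {V : Type*} {E : V → V → Prop} {I : V → Prop}

open Classical in
-- Threshold `0` admits the nodes of `I` at once, and threshold `1` admits a node as soon as one
-- predecessor is in.
theorem sat_iff_exists_path {q : V} :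
    Sat E (fun q => if I q then 0 else 1) q ↔ ∃ k, PathN E I k q := by
  constructor
  · intro h
    induction h with
    | @mk q s hs hE hc ih =>
      by_cases hI : I q
      · exact ⟨0, hI⟩
      · rw [if_neg hI] at hc
        obtain ⟨p, hp⟩ := Finset.card_pos.1 hc
        obtain ⟨k, hk⟩ := ih p hp
        exact ⟨k + 1, p, hk, hE p hp⟩
  · rintro ⟨k, hk⟩
    induction k generalizing q with
    | zero => exact .mk ∅ (by simp) (by simp) (by simp [show I q from hk])
    | succ k ih =>
      obtain ⟨p, hp, hE⟩ := hk
      refine .mk {p} (by simpa using ih hp) (by simpa using hE) ?_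
      split_ifs <;> simp

open Classical in
/-- The number of predecessors of a node that can be reached from `I`, and zero for other nodes. -/
noncomputable def peelThreshold [Fintype V] (E : V → V → Prop) (I : V → Prop) (q : V) : ℕ :=
  if ∃ k, PathN E I k q then (Finset.univ.filter fun p => E p q).card else 0

theorem peelThreshold_le [Fintype V] (q : V) : peelThreshold E I q ≤ Fintype.card V := by
  unfold peelThreshold
  split_ifs
  · exact Finset.card_le_univ _
  · exact Nat.zero_le _

open Classical in
-- Peeling: a reachable node is saturated only when all its predecessors are, which bounds the
-- lengths of the paths to it. An unsaturated node is reachable and has an unsaturated predecessor,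
-- so going back `k` steps and then to `I` gives a path of length at least `k`.
theorem not_sat_iff_unbounded [Fintype V] {q : V} :
    ¬ Sat E (peelThreshold E I) q ↔ ∀ k, ∃ k', k ≤ k' ∧ PathN E I k' q := by
  constructor
  · intro h k
    induction k generalizing q with
    | zero =>
      by_contra hn
      refine h (.mk ∅ (by simp) (by simp) ?_)
      rw [peelThreshold, if_neg]
      · simp
      · rintro ⟨k, hk⟩
        exact hn ⟨k, Nat.zero_le k, hk⟩
    | succ k ih =>
      by_contra hn
      refine h (.mk (Finset.univ.filter fun p => E p q) (fun p hp => ?_)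
        (fun p hp => (Finset.mem_filter.1 hp).2) ?_)
      · by_contra hp'
        obtain ⟨k', h1, h2⟩ := ih hp'
        exact hn ⟨k' + 1, by omega, p, h2, (Finset.mem_filter.1 hp).2⟩
      · rw [peelThreshold]
        split_ifs <;> simp
  · intro h hs
    suffices ∃ m, ∀ k, PathN E I k q → k ≤ m by
      obtain ⟨m, hm⟩ := this
      obtain ⟨k, h1, h2⟩ := h (m + 1)
      have := hm k h2
      omega
    clear h
    induction hs with
    | @mk q s hs hE hc ih =>
      by_cases hR : ∃ k, PathN E I k q
      · rw [peelThreshold, if_pos hR] at hc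
        -- The threshold is the full in-degree, so `s` must contain every predecessor.
        have hs' : s = Finset.univ.filter fun p => E p q :=
          Finset.eq_of_subset_of_card_le (fun p hp => by simpa using hE p hp) hc
        have ih' : ∀ p, ∃ m, p ∈ s → ∀ k, PathN E I k p → k ≤ m := fun p => by
          by_cases hp : p ∈ s
          · obtain ⟨m, hm⟩ := ih p hp
            exact ⟨m, fun _ => hm⟩
          · exact ⟨0, fun h => absurd h hp⟩
        choose m hm using ih'
        refine ⟨s.sup m + 1, fun k hk => ?_⟩
        cases k with
        | zero => exact Nat.zero_le _
        | succ k =>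
          obtain ⟨p, hp, hE⟩ := hk
          have hps : p ∈ s := by simpa [hs'] using hE
          exact Nat.succ_le_succ ((hm p hps k hp).trans (Finset.le_sup hps))
      · exact ⟨0, fun k hk => absurd ⟨k, hk⟩ hR⟩

end

end RAM

namespace LSTS

open RAM

/-! ## Observable steps -/

section Observable

variable {X T Y : Type*} {S : LSTS X T Y} {x y z : X}

/-- An unobservable transition. -/
def EpsStep (S : LSTS X T Y) (x y : X) : Prop :=
  ∃ t, S.label t = none ∧ S.trans x t y

/-- `y` can be reached from `x` without any output. -/
def Eps (S : LSTS X T Y) (x y : X) : Prop :=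
  ∃ s, S.Steps x s y ∧ S.word s = []

/-- The observable event `t`, preceded and followed by unobservable ones, leads from `x` to `y`. -/
def ObsStep (S : LSTS X T Y) (t : T) (x y : X) : Prop :=
  S.label t ≠ none ∧ ∃ u v, S.Eps x u ∧ S.trans u t v ∧ S.Eps v y

/-- A pair of observable steps with the same label. -/
def SyncStep (S : LSTS X T Y) (p q : X × X) : Prop :=
  ∃ t t', S.label t = S.label t' ∧ S.ObsStep t p.1 q.1 ∧ S.ObsStep t' p.2 q.2

/-- Both components can be reached from initial states without any output. -/
def SyncInit (S : LSTS X T Y) (p : X × X) : Prop :=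
  (∃ x ∈ S.init, S.Eps x p.1) ∧ ∃ x ∈ S.init, S.Eps x p.2

theorem Eps.refl (x : X) : S.Eps x x := ⟨[], .nil x, rfl⟩

theorem Eps.trans (h : S.Eps x y) (h' : S.Eps y z) : S.Eps x z := by
  obtain ⟨s, h1, h2⟩ := h
  obtain ⟨u, h3, h4⟩ := h'
  exact ⟨s ++ u, h1.append h3, by simp [h2, h4]⟩

/-- With the left component frozen as the starting point, the closure for all pairs of states is one
reachability problem from the diagonal. -/
theorem exists_path_epsStep_iff {p : X × X} :
    (∃ k, PathN (fun p q : X × X => p.1 = q.1 ∧ S.EpsStep p.2 q.2) (fun p => p.1 = p.2) k p) ↔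
      S.Eps p.1 p.2 := by
  constructor
  · rintro ⟨k, hk⟩
    induction k generalizing p with
    | zero => exact show S.Eps p.1 p.2 from (show p.1 = p.2 from hk) ▸ .refl _
    | succ k ih =>
      obtain ⟨q, hq, h1, t, h2, h3⟩ := hk
      exact h1 ▸ (ih hq).trans ⟨[t], .single h3, word_cons_none h2⟩
  · obtain ⟨x, y⟩ := p
    rintro ⟨s, hs, hw⟩
    -- The start `a` is decoupled from `x`, since the induction removes events in front while
    -- `PathN` grows at its end.
    suffices h : ∀ a, (∃ k, PathN (fun p q : X × X => p.1 = q.1 ∧ S.EpsStep p.2 q.2)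
        (fun p => p.1 = p.2) k (a, x)) → ∃ k, PathN (fun p q : X × X => p.1 = q.1 ∧
        S.EpsStep p.2 q.2) (fun p => p.1 = p.2) k (a, y) from h x ⟨0, rfl⟩
    intro a ha
    dsimp only at hs
    induction hs with
    | nil x => exact ha
    | @cons x z y t s ht _ ih =>
      cases hl : S.label t with
      | none =>
        rw [word_cons_none hl] at hw
        obtain ⟨k, hk⟩ := ha
        exact ih hw ⟨k + 1, (a, x), hk, rfl, t, hl, ht⟩
      | some c => simp [word_cons_some hl] at hw

theorem mem_possibleStates_nil : x ∈ S.possibleStates [] ↔ ∃ x₀ ∈ S.init, S.Eps x₀ x :=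
  ⟨fun ⟨x₀, h0, s, hw, hs⟩ => ⟨x₀, h0, s, hs, hw⟩, fun ⟨x₀, h0, s, hs, hw⟩ => ⟨x₀, h0, s, hw, hs⟩⟩

theorem mem_possibleStates_concat {w : List Y} {c : Y} :
    x ∈ S.possibleStates (w ++ [c]) ↔
      ∃ y ∈ S.possibleStates w, ∃ t, S.label t = some c ∧ S.ObsStep t y x := by
  constructor
  · rintro ⟨x₀, h0, s, hw, hs⟩
    obtain ⟨a, b, y, h1, h2, h3, h4⟩ := hs.split_word hw
    obtain ⟨a', t, b', u, v, g1, g2, g3, g4, g5, g6⟩ := h3.split_cons h4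
    exact ⟨y, ⟨x₀, h0, a, h2, h1⟩, t, g4, by simp [g4], u, v, ⟨a', g1, g2⟩, g3, b', g5, g6⟩
  · rintro ⟨y, ⟨x₀, h0, a, h2, h1⟩, t, g4, -, u, v, ⟨a', g1, g2⟩, g3, b', g5, g6⟩
    exact ⟨x₀, h0, a ++ (a' ++ t :: b'), by simp [word_cons_some g4, h2, g2, g6],
      h1.append (g1.append (.cons g3 g5))⟩

/-- Unobservable events are absorbed into the steps, so path length counts observations. -/
theorem path_syncStep_iff {k : ℕ} {p : X × X} : PathN S.SyncStep S.SyncInit k p ↔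
    ∃ w : List Y, w.length = k ∧ p.1 ∈ S.possibleStates w ∧ p.2 ∈ S.possibleStates w := by
  induction k generalizing p with
  | zero =>
    simp only [List.length_eq_zero_iff, exists_eq_left, mem_possibleStates_nil]
    rfl
  | succ k ih =>
    constructor
    · rintro ⟨q, hq, t, t', hl, h1, h2⟩
      obtain ⟨w, hw, g1, g2⟩ := ih.1 hq
      obtain ⟨c, hc⟩ := Option.ne_none_iff_exists'.1 h1.1
      exact ⟨w ++ [c], by simp [hw], mem_possibleStates_concat.2 ⟨_, g1, t, hc, h1⟩,
        mem_possibleStates_concat.2 ⟨_, g2, t', hl ▸ hc, h2⟩⟩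
    · rintro ⟨w, hw, h1, h2⟩
      rcases List.eq_nil_or_concat' w with rfl | ⟨w, c, rfl⟩
      · simp at hw
      · obtain ⟨x, hx, t, ht, hx'⟩ := mem_possibleStates_concat.1 h1
        obtain ⟨y, hy, t', ht', hy'⟩ := mem_possibleStates_concat.1 h2
        exact ⟨(x, y), ih.2 ⟨w, by simpa using hw, hx, hy⟩, t, t', ht.trans ht'.symm, hx', hy'⟩

/-- The edges are reversed because peeling measures paths that end at a node. The left component is
inert; it makes the nodes pairs, so that the same saturation program applies. -/
theorem path_obsStep_iff {k : ℕ} {p : X × X} :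
    PathN (fun p q : X × X => p.1 = q.1 ∧ ∃ t, S.ObsStep t q.2 p.2) (fun _ => True) k p ↔
      ∃ s y, S.Steps p.2 s y ∧ (S.word s).length = k := by
  induction k generalizing p with
  | zero => exact ⟨fun _ => ⟨[], p.2, .nil _, rfl⟩, fun _ => trivial⟩
  | succ k ih =>
    constructor
    · rintro ⟨q, hq, -, t, ht, u, v, ⟨a, g1, g2⟩, g3, b, g5, g6⟩
      obtain ⟨s, y, hs, hw⟩ := ih.1 hq
      obtain ⟨c, hc⟩ := Option.ne_none_iff_exists'.1 ht
      exact ⟨(a ++ t :: b) ++ s, y, (g1.append (.cons g3 g5)).append hs,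
        by simp [word_cons_some hc, g2, g6, hw]⟩
    · rintro ⟨s, y, hs, hw⟩
      obtain ⟨c, w, hw'⟩ := List.exists_cons_of_length_eq_add_one hw
      obtain ⟨a, t, b, u, v, h1, h2, h3, h4, h5, h6⟩ := hs.split_cons hw'
      refine ⟨(p.1, v), ih.2 ⟨b, y, h5, ?_⟩, rfl, t, by simp [h4], u, v, ⟨a, h1, h2⟩, h3, .refl v⟩
      rw [hw'] at hw
      rw [h6]
      simpa using hw

theorem live_iff_path [Finite X] {p : X × X} : S.Live p.2 ↔ ∀ k, ∃ k', k ≤ k' ∧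
    PathN (fun p q : X × X => p.1 = q.1 ∧ ∃ t, S.ObsStep t q.2 p.2) (fun _ => True) k' p := by
  simp only [live_iff_unbounded, path_obsStep_iff]
  exact forall_congr' fun k => ⟨fun ⟨s, y, h1, h2⟩ => ⟨_, h2, s, y, h1, rfl⟩,
    fun ⟨_, h2, s, y, h1, h3⟩ => ⟨s, y, h1, h3 ▸ h2⟩⟩

/-- In `Ambiguous` the two states may depend on `k`; as there are finitely many pairs, one pair
serves for all `k`. -/
theorem ambiguous_iff_path [Finite X] : S.Ambiguous ↔ ∃ x y, x ≠ y ∧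
    (∀ k, ∃ k', k ≤ k' ∧ PathN S.SyncStep S.SyncInit k' (x, y)) ∧ S.Live x := by
  simp only [path_syncStep_iff]
  constructor
  · intro h
    by_contra! hc
    have : ∀ p : X × X, ∃ k, p.1 ≠ p.2 → S.Live p.1 → ∀ w : List Y, p.1 ∈ S.possibleStates w →
        p.2 ∈ S.possibleStates w → w.length < k := by
      intro p
      by_contra! hn
      obtain ⟨h1, h2, -⟩ := hn 0
      refine hc p.1 p.2 h1 (fun k => ?_) h2
      obtain ⟨-, -, w, h3, h4, h5⟩ := hn k
      exact ⟨w.length, h5, w, rfl, h3, h4⟩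
    choose k hk using this
    obtain ⟨m, hm⟩ := (Set.finite_range k).bddAbove
    obtain ⟨w, hw, x, hx, y, hy, hne, hl⟩ := h m
    have h1 := hk (x, y) hne hl w hx hy
    have h2 : k (x, y) ≤ m := hm ⟨_, rfl⟩
    omega
  · rintro ⟨x, y, hne, h, hl⟩ k
    obtain ⟨k', hk, w, hw, hx, hy⟩ := h (k + 1)
    exact ⟨w, by omega, x, hx, y, hy, hne, hl⟩

end Observable

end LSTS

namespace RAM

/-! ## The decision program -/

/-- The characteristic number of a proposition. -/
noncomputable def ind (P : Prop) : ℕ :=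
  open Classical in if P then 1 else 0

theorem ind_mul (P Q : Prop) : ind P * ind Q = ind (P ∧ Q) := by
  by_cases hP : P <;> by_cases hQ : Q <;> simp [ind, hP, hQ]

theorem one_sub_ind (P : Prop) : 1 - ind P = ind (¬ P) := by
  by_cases hP : P <;> simp [ind, hP]

theorem ind_pos (P : Prop) : 0 < ind P ↔ P := by
  by_cases hP : P <;> simp [ind, hP]

theorem ind_le_one (P : Prop) : ind P ≤ 1 := by
  by_cases hP : P <;> simp [ind, hP]

theorem ind_congr {P Q : Prop} (h : P ↔ Q) : ind P = ind Q := by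
  rw [propext h]

theorem Op.eval_equal (a b : ℕ) : Op.equal.eval a b = ind (a = b) := by
  by_cases h : a = b <;> simp [Op.eval, ind, h]

theorem Op.eval_less (a b : ℕ) : Op.less.eval a b = ind (a < b) := by
  by_cases h : a < b <;> simp [Op.eval, ind, h]

theorem sum_range_equiv {X : Type*} [Fintype X] {n : ℕ} (e : X ≃ Fin n) (f : ℕ → ℕ) :
    ∑ j ∈ Finset.range n, f j = ∑ x, f (e x) := by
  rw [Finset.sum_range, ← e.sum_comp]

theorem forall_lt_iff_equiv {X : Type*} {n : ℕ} (e : X ≃ Fin n) {P : ℕ → Prop} :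
    (∀ j < n, P j) ↔ ∀ x, P (e x) :=
  ⟨fun h x => h _ (e x).2, fun h j hj => by simpa using h (e.symm ⟨j, hj⟩)⟩

theorem sum_pos_iff_exists {X : Type*} [Fintype X] (f : X → ℕ) :
    0 < ∑ x, f x ↔ ∃ x, 0 < f x := by
  rw [pos_iff_ne_zero, Ne, Finset.sum_eq_zero_iff]
  simp [pos_iff_ne_zero]

open Classical in
theorem sum_ind {X : Type*} [Fintype X] (P : X → Prop) :
    ∑ x, ind (P x) = (Finset.univ.filter P).card := by
  simp only [ind]
  rw [Finset.card_filter]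

/-- The sizes of a problem instance. -/
def sizes (X T : Type*) [Fintype X] [Fintype T] : Fin 3 → ℕ :=
  ![Fintype.card X, Fintype.card T, Fintype.card X * Fintype.card X]

section Sizes

variable (X T : Type*) [Fintype X] [Fintype T]

theorem sizes_zero : sizes X T 0 = Fintype.card X := rfl

theorem sizes_one : sizes X T 1 = Fintype.card T := rfl

theorem sizes_two : sizes X T 2 = Fintype.card X * Fintype.card X := rfl

variable {X}

/-- The numbering of the pairs of states. -/
def pairEquiv (eX : X ≃ Fin (Fintype.card X)) : X × X ≃ Fin (sizes X T 2) :=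
  (eX.prodCongr eX).trans finProdFinEquiv

theorem pairEquiv_apply (eX : X ≃ Fin (Fintype.card X)) (x y : X) :
    (pairEquiv T eX (x, y) : ℕ) = eX x * Fintype.card X + eX y := by
  change (eX y : ℕ) + Fintype.card X * (eX x : ℕ) = _
  ring

end Sizes

/-- Requirements on the word size `W`, where `K` bounds the data. -/
structure WordSize (X T : Type*) [Fintype X] [Fintype T] (W K : ℕ) : Prop where
  two_le : 2 ≤ K
  sizes_lt : ∀ i, sizes X T i < K
  pow_le : K ^ 50 ≤ W

namespace Term

/-- Sum of two terms. -/
abbrev add (e f : Term) : Term := .bin .plus e f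

/-- Product of two terms. -/
abbrev mul (e f : Term) : Term := .bin .times e f

/-- Equality test. -/
abbrev eq (e f : Term) : Term := .bin .equal e f

/-- Positivity test. -/
abbrev pos (e : Term) : Term := .bin .less (.lit 0) e

/-- Negation of a truth value. -/
abbrev not (e : Term) : Term := .bin .minus (.lit 1) e

/-- Bounded sum. -/
abbrev sum (n : Fin 3) (e : Term) : Term := .fold false n e

/-- The index of a pair of states. -/
abbrev pair (e f : Term) : Term := .add (.mul e (.size 0)) f

/-- The label of an event, in the input. -/
abbrev labelOf (t : Term) : Term := .cell 0 (.add (.lit 3) t)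

/-- Membership in the set of initial states, in the input. -/
abbrev initOf (x : Term) : Term := .cell 0 (.add (.add (.lit 3) (.size 1)) x)

/-- The transition relation, in the input. -/
abbrev transOf (x t y : Term) : Term :=
  .cell 0 (.add (.add (.add (.lit 3) (.size 1)) (.size 0))
    (.add (.mul (.size 0) (.add (.mul (.size 1) x) t)) y))

/-- Reachability by unobservable events. -/
abbrev epsOf (x y : Term) : Term := .cell 6 (pair x y)

/-- Reachability by one observable event and unobservable events. -/
abbrev obsOf (x t y : Term) : Term :=
  .cell 7 (.add (.mul (.add (.mul x (.size 1)) t) (.size 0)) y)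

end Term

/-- Compute a matrix, thresholds, and the resulting saturation. -/
def solve (e c : Term) : Program :=
  .seq (tab 1 e 0 (.lit 0) [0, 0, 0, 0]) (.seq (tab 2 c 0 (.lit 0) [0, 0]) satProg)

section Solve

variable {X T : Type*} [Fintype X] [Fintype T] {W K : ℕ} {v : ℕ → ℕ} {A : ℕ → ℕ → ℕ}

/-- `hC` evaluates the thresholds after array `1` has been replaced but with the other arrays as
before. They may thus depend on the new matrix and on the previous result in array `3`. -/
theorem does_solve (hWK : WordSize X T W K) (eX : X ≃ Fin (Fintype.card X))
    (hA : ∀ a i, A a i < K) (e c : Term) (he : e.wf 4) (he' : e.reads 1 = false)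
    (hc : c.wf 2) (hc' : c.reads 2 = false) (hwe : e.width ≤ 50) (hwc : c.width ≤ 50)
    (E : X × X → X × X → Prop) (f : X × X → ℕ) (hf : ∀ p, f p < K)
    (hE : ∀ x x' y y', e.val (sizes X T) A 4 (Function.update (Function.update (Function.update
      (Function.update v 0 (eX x)) 1 (eX x')) 2 (eX y)) 3 (eX y')) = ind (E (x, x') (y, y')))
    (hC : ∀ A' : ℕ → ℕ → ℕ, (∀ a, a ≠ 1 → A' a = A a) →
      (∀ p q, A' 1 (pairEquiv T eX p * sizes X T 2 + pairEquiv T eX q) = ind (E p q)) →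
      ∀ x y, c.val (sizes X T) A' 2 (Function.update (Function.update v 0 (eX x)) 1 (eX y)) =
        f (x, y))
    {b : ℕ} (hb : tabCost (sizes X T) e (.lit 0) [0, 0, 0, 0] +
      (tabCost (sizes X T) c (.lit 0) [0, 0] +
        (sizes X T 2 * (sizes X T 2 * 300 + 400) + 100)) ≤ b) :
    Does W (sizes X T) 0 v (solve e c) b A fun A' =>
      (∀ a, (a = 0 ∨ 5 < a) → A' a = A a) ∧ (∀ a i, A' a i < K) ∧
      ∀ x y, A' 3 (eX x * Fintype.card X + eX y) = ind (Sat E f (x, y)) := by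
  have hv : ∀ m < 0, v m < K := fun m hm => absurd hm (Nat.not_lt_zero m)
  refine Does.seq_budget (Does.fill hWK.two_le hWK.sizes_lt hWK.pow_le hv hA 1 e [0, 0, 0, 0] he
    he' hwe (by decide) ?_) (by omega) ?_
  · simp only [ForallIdx, sizes_zero, forall_lt_iff_equiv eX]
    intro x x' y y'
    exact (hE x x' y y').trans_lt ((ind_le_one _).trans_lt hWK.two_le)
  rintro A₁ ⟨f1, b1, g1⟩
  simp only [ForallIdx, sizes_zero, forall_lt_iff_equiv eX] at g1
  have h1 : ∀ p q, A₁ 1 (pairEquiv T eX p * sizes X T 2 + pairEquiv T eX q) = ind (E p q) := by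
    rintro ⟨x, x'⟩ ⟨y, y'⟩
    have := (g1 x x' y y').trans (hE x x' y y')
    rw [← this, pairEquiv_apply, pairEquiv_apply, sizes_two]
    congr 1
    ring
  have hC' := hC A₁ f1 h1
  refine Does.seq_budget (Does.fill hWK.two_le hWK.sizes_lt hWK.pow_le hv b1 2 c [0, 0] hc
    hc' hwc (by decide) ?_) (by omega) ?_
  · simp only [ForallIdx, sizes_zero, forall_lt_iff_equiv eX]
    intro x y
    exact (hC' x y).trans_lt (hf _)
  rintro A₂ ⟨f2, b2, g2⟩
  simp only [ForallIdx, sizes_zero, forall_lt_iff_equiv eX, zero_mul, zero_add] at g2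
  refine ((does_sat (pairEquiv T eX) E f hWK.two_le hWK.sizes_lt hWK.pow_le (by decide) b2
    (fun p q => ?_) ?_).mono ?_).mono_cost (by omega)
  · rw [f2 1 (by decide), h1]
    rfl
  · rintro ⟨x, y⟩
    rw [pairEquiv_apply, g2, hC']
  · rintro A₃ ⟨f3, b3, g3⟩
    refine ⟨fun a ha => ?_, b3, fun x y => ?_⟩
    · rw [f3 a (by omega), f2 a (by omega), f1 a (by omega)]
    · rw [← pairEquiv_apply T, g3]
      rfl

/-- Monomials of low degree are bounded by the time bound. -/
theorem pow_mul_pow_le {x t : ℕ} (hx : 0 < x) (ht : 0 < t) {i j : ℕ} (hi : i ≤ 4) (hj : j ≤ 2) :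
    x ^ i * t ^ j ≤ x ^ 4 * t ^ 2 :=
  Nat.mul_le_mul (Nat.pow_le_pow_right hx hi) (Nat.pow_le_pow_right ht hj)

end Solve

end RAM

namespace RAM

/-! ### The terms for the matrices, thresholds and answer -/

section Stages

open LSTS

variable {X T Y : Type*} [Fintype X] [Fintype T]

/-- The presentation of an automaton in an array. -/
structure IsInput (S : LSTS X T Y) (eX : X ≃ Fin (Fintype.card X)) (eT : T ≃ Fin (Fintype.card T))
    (a : ℕ → ℕ) : Prop where
  unobservable : ∀ t, a (3 + eT t) = 0 ↔ S.label t = none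
  label_eq : ∀ t t', a (3 + eT t) = a (3 + eT t') ↔ S.label t = S.label t'
  init : ∀ x, a (3 + Fintype.card T + eX x) = ind (x ∈ S.init)
  trans : ∀ x t y, a (3 + Fintype.card T + Fintype.card X +
    (Fintype.card X * (Fintype.card T * eX x + eT t) + eX y)) = ind (S.trans x t y)

theorem IsInput.observable {S : LSTS X T Y} {eX : X ≃ Fin (Fintype.card X)}
    {eT : T ≃ Fin (Fintype.card T)} {a : ℕ → ℕ} (h : IsInput S eX eT a) (t : T) :
    0 < a (3 + eT t) ↔ S.label t ≠ none := by
  rw [pos_iff_ne_zero, Ne, h.unobservable]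

namespace Term

/-- The unobservable transitions, on the right components of pairs. -/
def epsMatrix : Term :=
  .mul (.eq (.var 0) (.var 2))
    (.pos (.sum 1 (.mul (.eq (labelOf (.var 4)) (.lit 0)) (transOf (.var 1) (.var 4) (.var 3)))))

/-- The thresholds for the pairs reachable from the diagonal. -/
def epsThreshold : Term := .not (.eq (.var 0) (.var 1))

/-- The observable steps. -/
def obsArray : Term :=
  .mul (.pos (labelOf (.var 1))) (.pos (.sum 0 (.sum 0 (.mul (.mul (epsOf (.var 0) (.var 3))
    (transOf (.var 3) (.var 1) (.var 4))) (epsOf (.var 4) (.var 2))))))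

/-- The synchronized steps. -/
def syncMatrix : Term :=
  .pos (.sum 1 (.sum 1 (.mul (.eq (labelOf (.var 4)) (labelOf (.var 5)))
    (.mul (obsOf (.var 0) (.var 4) (.var 2)) (obsOf (.var 1) (.var 5) (.var 3))))))

/-- The thresholds for the reachable pairs. -/
def syncThreshold : Term :=
  .not (.mul (.pos (.sum 0 (.mul (initOf (.var 2)) (epsOf (.var 2) (.var 0)))))
    (.pos (.sum 0 (.mul (initOf (.var 2)) (epsOf (.var 2) (.var 1))))))

/-- The number of predecessors of a pair. -/
def indegree : Term :=
  .sum 2 (.cell 1 (.add (.mul (.var 2) (.size 2)) (pair (.var 0) (.var 1))))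

/-- The number of predecessors of a pair that is marked, and zero otherwise. -/
def markedIndegree : Term := .mul (.cell 3 (pair (.var 0) (.var 1))) indegree

/-- The reversed observable steps, on the right components of pairs. -/
def liveMatrix : Term :=
  .mul (.eq (.var 0) (.var 2)) (.pos (.sum 1 (obsOf (.var 3) (.var 4) (.var 1))))

/-- The answer. -/
def answer : Term :=
  .not (.pos (.sum 0 (.sum 0 (.mul (.not (.eq (.var 0) (.var 1)))
    (.mul (.not (.cell 8 (pair (.var 0) (.var 1)))) (.not (.cell 3 (pair (.var 1) (.var 0)))))))))

end Term

variable {S : LSTS X T Y} {eX : X ≃ Fin (Fintype.card X)} {eT : T ≃ Fin (Fintype.card T)}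
  {A : ℕ → ℕ → ℕ} {v : ℕ → ℕ}

/-- Coordinates of a quadruple. -/
abbrev upd4 (v : ℕ → ℕ) (a b c d : ℕ) : ℕ → ℕ :=
  Function.update (Function.update (Function.update (Function.update v 0 a) 1 b) 2 c) 3 d

theorem Op.eval_plus (a b : ℕ) : Op.plus.eval a b = a + b := rfl

theorem Op.eval_times (a b : ℕ) : Op.times.eval a b = a * b := rfl

theorem Op.eval_minus (a b : ℕ) : Op.minus.eval a b = a - b := rfl

theorem coe_inj_iff {X : Type*} {n : ℕ} (e : X ≃ Fin n) {x y : X} : (e x : ℕ) = e y ↔ x = y := by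
  rw [Fin.val_inj, e.injective.eq_iff]

/-- Truth values are the numbers `0` and `1`: a product is a conjunction, and a positive bounded sum
is an existential quantifier. The other evaluations below rest on the same dictionary. -/
theorem val_epsMatrix (hI : IsInput S eX eT (A 0)) (x x' y y' : X) :
    Term.epsMatrix.val (sizes X T) A 4 (upd4 v (eX x) (eX x') (eX y) (eX y')) =
      ind (x = y ∧ S.EpsStep x' y') := by
  simp [Term.epsMatrix, Term.val, Op.eval_equal, Op.eval_less, Op.eval_plus, Op.eval_times, foldVal_false, sizes_zero, upd4,
    sizes_one, sum_range_equiv eT, Function.update_of_ne, ind_mul, hI.trans, hI.unobservable,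
    sum_pos_iff_exists, ind_pos, coe_inj_iff, EpsStep]

theorem val_epsThreshold (x y : X) : Term.epsThreshold.val (sizes X T) A 2
    (Function.update (Function.update v 0 (eX x)) 1 (eX y)) = ind (x ≠ y) := by
  simp [Term.epsThreshold, Term.val, Op.eval_equal, Op.eval_minus, Function.update_of_ne, one_sub_ind,
    coe_inj_iff]

theorem val_obsArray (hI : IsInput S eX eT (A 0))
    (h6 : ∀ x y, A 6 (eX x * Fintype.card X + eX y) = ind (S.Eps x y)) (x : X) (t : T) (y : X) :
    Term.obsArray.val (sizes X T) A 3 (Function.update (Function.update (Function.update v 0 (eX x))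
      1 (eT t)) 2 (eX y)) = ind (S.ObsStep t x y) := by
  simp [Term.obsArray, Term.val, Op.eval_less, Op.eval_plus, Op.eval_times, foldVal_false, sizes_zero,
    sizes_one, sum_range_equiv eX, Function.update_of_ne, ind_mul, hI.trans,
    sum_pos_iff_exists, ind_pos, ObsStep, hI.observable, h6, and_assoc]

theorem val_syncMatrix (hI : IsInput S eX eT (A 0))
    (h7 : ∀ x t y, A 7 ((eX x * Fintype.card T + eT t) * Fintype.card X + eX y) =
      ind (S.ObsStep t x y)) (x x' y y' : X) :
    Term.syncMatrix.val (sizes X T) A 4 (upd4 v (eX x) (eX x') (eX y) (eX y')) =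
      ind (S.SyncStep (x, x') (y, y')) := by
  simp [Term.syncMatrix, Term.val, Op.eval_equal, Op.eval_less, Op.eval_plus, Op.eval_times, foldVal_false, sizes_zero, upd4,
    sizes_one, sum_range_equiv eT, Function.update_of_ne, ind_mul, hI.label_eq,
    sum_pos_iff_exists, ind_pos, SyncStep, h7]

theorem val_syncThreshold (hI : IsInput S eX eT (A 0))
    (h6 : ∀ x y, A 6 (eX x * Fintype.card X + eX y) = ind (S.Eps x y)) (x y : X) :
    Term.syncThreshold.val (sizes X T) A 2
      (Function.update (Function.update v 0 (eX x)) 1 (eX y)) = ind (¬ S.SyncInit (x, y)) := by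
  simp [Term.syncThreshold, Term.val, Op.eval_less, Op.eval_plus, Op.eval_times, Op.eval_minus, foldVal_false, sizes_zero,
    sizes_one, sum_range_equiv eX, Function.update_of_ne, ind_mul, hI.init,
    sum_pos_iff_exists, ind_pos, SyncInit, h6, one_sub_ind]

open Classical in
theorem val_indegree {E : X × X → X × X → Prop}
    (h1 : ∀ p q, A 1 (pairEquiv T eX p * sizes X T 2 + pairEquiv T eX q) = ind (E p q)) (x y : X) :
    Term.indegree.val (sizes X T) A 2 (Function.update (Function.update v 0 (eX x)) 1 (eX y)) =
      (Finset.univ.filter fun p => E p (x, y)).card := by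
  simp only [Term.indegree, Term.val, foldVal_false,
    sum_range_equiv (pairEquiv T eX), Op.eval_plus, Op.eval_times, sizes_zero]
  simp [← pairEquiv_apply T, h1, sum_ind, Function.update_of_ne]

theorem val_liveMatrix
    (h7 : ∀ x t y, A 7 ((eX x * Fintype.card T + eT t) * Fintype.card X + eX y) =
      ind (S.ObsStep t x y)) (x x' y y' : X) :
    Term.liveMatrix.val (sizes X T) A 4 (upd4 v (eX x) (eX x') (eX y) (eX y')) =
      ind (x = y ∧ ∃ t, S.ObsStep t y' x') := by
  simp [Term.liveMatrix, Term.val, Op.eval_equal, Op.eval_less, Op.eval_plus, Op.eval_times, foldVal_false, sizes_zero, upd4,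
    sizes_one, sum_range_equiv eT, Function.update_of_ne, ind_mul,
    sum_pos_iff_exists, ind_pos, h7, coe_inj_iff]

/-- `Q` occurs with swapped arguments because liveness is computed for right components, but is
needed for the left state `x`. -/
theorem val_answer {P Q : X → X → Prop}
    (h8 : ∀ x y, A 8 (eX x * Fintype.card X + eX y) = ind (P x y))
    (h3 : ∀ x y, A 3 (eX x * Fintype.card X + eX y) = ind (Q x y)) :
    Term.answer.val (sizes X T) A 0 v = ind (¬ ∃ x y, x ≠ y ∧ ¬ P x y ∧ ¬ Q y x) := by
  simp [Term.answer, Term.val, Op.eval_equal, Op.eval_less, Op.eval_plus, Op.eval_times, Op.eval_minus, foldVal_false, sizes_zero,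
    sum_range_equiv eX, Function.update_of_ne, ind_mul,
    sum_pos_iff_exists, ind_pos, h8, h3, coe_inj_iff, one_sub_ind, -not_exists]

end Stages

end RAM

namespace RAM

/-! ### Correctness and running time of the analysis -/

section Main

open LSTS

variable {X T Y : Type*} [Fintype X] [Fintype T]

/-- Compute the observable steps, the synchronized pairs that can be reached within bounded time
only, and the states from which only bounded words can be generated. -/
def analyze : Program :=
  .seq (solve .epsMatrix .epsThreshold) <|
  .seq (tab 6 (.cell 3 (.pair (.var 0) (.var 1))) 0 (.lit 0) [0, 0]) <|
  .seq (tab 7 .obsArray 0 (.lit 0) [0, 1, 0]) <|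
  .seq (solve .syncMatrix .syncThreshold) <|
  .seq (solve .syncMatrix .markedIndegree) <|
  .seq (tab 8 (.cell 3 (.pair (.var 0) (.var 1))) 0 (.lit 0) [0, 0])
  (solve .liveMatrix .indegree)

/-- Only the synchronized steps reach the monomial `|X|^4 |T|^2`; the lower monomials are absorbed
by it because both sizes are positive. -/
theorem analyze_cost_le {sz : Fin 3 → ℕ} (h0 : 0 < sz 0) (h1 : 0 < sz 1)
    (h2 : sz 2 = sz 0 * sz 0) {e c : Term}
    (h : (e, c) ∈ [(Term.epsMatrix, Term.epsThreshold), (.syncMatrix, .syncThreshold),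
      (.syncMatrix, .markedIndegree), (.liveMatrix, .indegree)]) :
    tabCost sz e (.lit 0) [0, 0, 0, 0] + (tabCost sz c (.lit 0) [0, 0] +
      (sz 2 * (sz 2 * 300 + 400) + 100)) ≤ 10000 * (sz 0 ^ 4 * sz 1 ^ 2) := by
  have m00 := pow_mul_pow_le h0 h1 (i := 0) (j := 0) (by omega) (by omega)
  have m10 := pow_mul_pow_le h0 h1 (i := 1) (j := 0) (by omega) (by omega)
  have m20 := pow_mul_pow_le h0 h1 (i := 2) (j := 0) (by omega) (by omega)
  have m30 := pow_mul_pow_le h0 h1 (i := 3) (j := 0) (by omega) (by omega)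
  have m40 := pow_mul_pow_le h0 h1 (i := 4) (j := 0) (by omega) (by omega)
  have m41 := pow_mul_pow_le h0 h1 (i := 4) (j := 1) (by omega) (by omega)
  simp only [List.mem_cons, Prod.mk.injEq, List.not_mem_nil, or_false] at h
  rcases h with ⟨rfl, rfl⟩ | ⟨rfl, rfl⟩ | ⟨rfl, rfl⟩ | ⟨rfl, rfl⟩ <;>
    simp only [tabCost, Term.epsMatrix, Term.epsThreshold, Term.syncMatrix, Term.syncThreshold,
      Term.markedIndegree, Term.liveMatrix, Term.indegree, Term.cost, h2] <;>
    ring_nf at * <;> linarith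

theorem tab_cost_le {sz : Fin 3 → ℕ} (h0 : 0 < sz 0) (h1 : 0 < sz 1) :
    tabCost sz (.cell 3 (.pair (.var 0) (.var 1))) (.lit 0) [0, 0] ≤
      10000 * (sz 0 ^ 4 * sz 1 ^ 2) ∧
    tabCost sz .obsArray (.lit 0) [0, 1, 0] ≤ 10000 * (sz 0 ^ 4 * sz 1 ^ 2) ∧
    Term.answer.cost sz ≤ 10000 * (sz 0 ^ 4 * sz 1 ^ 2) := by
  have m00 := pow_mul_pow_le h0 h1 (i := 0) (j := 0) (by omega) (by omega)
  have m10 := pow_mul_pow_le h0 h1 (i := 1) (j := 0) (by omega) (by omega)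
  have m20 := pow_mul_pow_le h0 h1 (i := 2) (j := 0) (by omega) (by omega)
  have m11 := pow_mul_pow_le h0 h1 (i := 1) (j := 1) (by omega) (by omega)
  have m21 := pow_mul_pow_le h0 h1 (i := 2) (j := 1) (by omega) (by omega)
  have m31 := pow_mul_pow_le h0 h1 (i := 3) (j := 1) (by omega) (by omega)
  have m41 := pow_mul_pow_le h0 h1 (i := 4) (j := 1) (by omega) (by omega)
  refine ⟨?_, ?_, ?_⟩ <;>
    simp only [tabCost, Term.obsArray, Term.answer, Term.cost] <;>
    ring_nf at * <;> linarith

theorem ind_not (P : Prop) [Decidable P] : ind (¬ P) = if P then 0 else 1 := by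
  by_cases h : P <;> simp [ind, h]

open Classical in
theorem does_analyze {S : LSTS X T Y} {eX : X ≃ Fin (Fintype.card X)}
    {eT : T ≃ Fin (Fintype.card T)} {W K : ℕ} {v : ℕ → ℕ} {A : ℕ → ℕ → ℕ}
    (hWK : WordSize X T W K) (hI : IsInput S eX eT (A 0)) (hA : ∀ a i, A a i < K)
    (hX : 0 < Fintype.card X) (hT : 0 < Fintype.card T) :
    Does W (sizes X T) 0 v analyze (70000 * (Fintype.card X ^ 4 * Fintype.card T ^ 2)) A fun A' =>
      (∀ a i, A' a i < K) ∧
      (∀ x y, A' 8 (eX x * Fintype.card X + eX y) =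
        ind (¬ ∀ k, ∃ k', k ≤ k' ∧ PathN S.SyncStep S.SyncInit k' (x, y))) ∧
      ∀ x y, A' 3 (eX x * Fintype.card X + eX y) = ind (¬ S.Live y) := by
  have hv : ∀ m < 0, v m < K := fun m hm => absurd hm (Nat.not_lt_zero m)
  have hcost := fun {e c} => analyze_cost_le (sz := sizes X T) hX hT rfl (e := e) (c := c)
  obtain ⟨hcopy, hobs, -⟩ := tab_cost_le (sz := sizes X T) hX hT
  rw [sizes_zero, sizes_one] at hcopy hobs
  simp only [sizes_zero, sizes_one] at hcost
  set M := Fintype.card X ^ 4 * Fintype.card T ^ 2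
  have h01 : ∀ {P : Prop} [Decidable P], (if P then 0 else 1) < K := fun {P} _ => by
    have := hWK.two_le
    split_ifs <;> omega
  have hpeel : ∀ (E : X × X → X × X → Prop) I q, peelThreshold E I q < K := fun E I q => by
    refine lt_of_le_of_lt (peelThreshold_le _) ?_
    rw [Fintype.card_prod]
    exact hWK.sizes_lt 2
  refine Does.seq_budget (c₁ := 10000 * M) (does_solve hWK eX hA _ _ (by decide) (by decide)
    (by decide) (by decide) (by decide) (by decide)
    (fun p q => p.1 = q.1 ∧ S.EpsStep p.2 q.2) (fun q => if q.1 = q.2 then 0 else 1)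
    (fun _ => h01) (val_epsMatrix hI)
    (fun A' _ _ x y => (val_epsThreshold x y).trans (ind_not _)) (hcost (by simp)))
    (by omega) ?_
  rintro A₁ ⟨f1, b1, g1⟩
  have g1' : ∀ x y, A₁ 3 (eX x * Fintype.card X + eX y) = ind (S.Eps x y) := fun x y => by
    rw [g1]
    exact ind_congr (sat_iff_exists_path.trans (exists_path_epsStep_iff (p := (x, y))))
  refine Does.seq_budget (c₁ := 10000 * M) ((Does.fill hWK.two_le hWK.sizes_lt hWK.pow_le hv b1 6
    (.cell 3 (.pair (.var 0) (.var 1))) [0, 0] (by decide) (by decide) (by decide) (by decide)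
    (fun _ _ _ _ => b1 _ _)).mono_cost hcopy) (by omega) ?_
  rintro A₂ ⟨f2, b2, g2⟩
  have h6 : ∀ x y, A₂ 6 (eX x * Fintype.card X + eX y) = ind (S.Eps x y) := fun x y => by
    rw [← g1']
    simpa [ForallIdx, Term.val, Op.eval, sizes_zero, Function.update_of_ne] using
      g2 (eX x) (eX x).2 (eX y) (eX y).2
  have hI2 : IsInput S eX eT (A₂ 0) := by rwa [f2 0 (by decide), f1 0 (by decide)]
  refine Does.seq_budget (c₁ := 10000 * M) ((Does.fill hWK.two_le hWK.sizes_lt hWK.pow_le hv b2 7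
    .obsArray [0, 1, 0] (by decide) (by decide) (by decide) (by decide) ?_).mono_cost hobs)
    (by omega) ?_
  · simp only [ForallIdx, sizes_zero, sizes_one, forall_lt_iff_equiv eX, forall_lt_iff_equiv eT]
    intro x t y
    exact (val_obsArray hI2 h6 x t y).trans_lt ((ind_le_one _).trans_lt hWK.two_le)
  rintro A₃ ⟨f3, b3, g3⟩
  simp only [ForallIdx, sizes_zero, sizes_one, forall_lt_iff_equiv eX, forall_lt_iff_equiv eT,
    zero_mul, zero_add] at g3
  have h7 : ∀ x t y, A₃ 7 ((eX x * Fintype.card T + eT t) * Fintype.card X + eX y) =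
      ind (S.ObsStep t x y) := fun x t y => (g3 x t y).trans (val_obsArray hI2 h6 x t y)
  have hI3 : IsInput S eX eT (A₃ 0) := by rwa [f3 0 (by decide)]
  rw [← f3 6 (by decide)] at h6
  refine Does.seq_budget (c₁ := 10000 * M) (does_solve hWK eX b3 _ _ (by decide) (by decide)
    (by decide) (by decide) (by decide) (by decide) S.SyncStep
    (fun q => if S.SyncInit q then 0 else 1) (fun _ => h01) (val_syncMatrix hI3 h7)
    (fun A' hA' _ x y => (val_syncThreshold (by rwa [hA' 0 (by decide)])
      (by rwa [hA' 6 (by decide)]) x y).trans (ind_not _)) (hcost (by simp)))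
    (by omega) ?_
  rintro A₄ ⟨f4, b4, g4⟩
  simp only [sat_iff_exists_path] at g4
  rw [← f4 7 (by decide)] at h7
  have hI4 : IsInput S eX eT (A₄ 0) := by rwa [f4 0 (by decide)]
  refine Does.seq_budget (c₁ := 10000 * M) (does_solve hWK eX b4 _ _ (by decide) (by decide)
    (by decide) (by decide) (by decide) (by decide) S.SyncStep
    (peelThreshold S.SyncStep S.SyncInit) (hpeel _ _)
    (val_syncMatrix hI4 h7) ?_ (hcost (by simp))) (by omega) ?_
  -- Array `3` still marks the pairs reachable from the initial ones, so the marked in-degree is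
  -- `peelThreshold`.
  · intro A' hA' h1 x y
    simp only [Term.markedIndegree, Term.val, Op.eval_times, val_indegree h1]
    have := g4 x y
    rw [← hA' 3 (by decide)] at this
    simp only [Op.eval_plus, Function.update_self, sizes_zero,
      Function.update_of_ne zero_ne_one, this, ind, peelThreshold, ite_mul, one_mul, zero_mul]
  rintro A₅ ⟨f5, b5, g5⟩
  refine Does.seq_budget (c₁ := 10000 * M) ((Does.fill hWK.two_le hWK.sizes_lt hWK.pow_le hv b5 8
    (.cell 3 (.pair (.var 0) (.var 1))) [0, 0] (by decide) (by decide) (by decide) (by decide)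
    (fun _ _ _ _ => b5 _ _)).mono_cost hcopy) (by omega) ?_
  rintro A₆ ⟨f6, b6, g6⟩
  -- Saved in array `8`, as the last saturation overwrites array `3`.
  have h8 : ∀ x y, A₆ 8 (eX x * Fintype.card X + eX y) =
      ind (¬ ∀ k, ∃ k', k ≤ k' ∧ PathN S.SyncStep S.SyncInit k' (x, y)) := fun x y => by
    rw [← not_sat_iff_unbounded, not_not, ← g5]
    simpa [ForallIdx, Term.val, Op.eval, sizes_zero, Function.update_of_ne] using
      g6 (eX x) (eX x).2 (eX y) (eX y).2
  rw [← f5 7 (by decide), ← f6 7 (by decide)] at h7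
  refine (does_solve (b := 10000 * M) hWK eX b6 _ _ (by decide) (by decide)
    (by decide) (by decide) (by decide) (by decide)
    (fun p q => p.1 = q.1 ∧ ∃ t, S.ObsStep t q.2 p.2)
    (peelThreshold (fun p q => p.1 = q.1 ∧ ∃ t, S.ObsStep t q.2 p.2) fun _ => True) (hpeel _ _)
    (val_liveMatrix h7) ?_ (hcost (by simp))).mono_cost (by omega) |>.mono ?_
  -- All nodes are starting points here, so the threshold is the plain in-degree.
  · intro A' _ h1 x y
    rw [val_indegree h1, peelThreshold, if_pos ⟨0, trivial⟩]
  · rintro A₇ ⟨f7, b7, g7⟩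
    refine ⟨b7, by rwa [f7 8 (by decide)], fun x y => ?_⟩
    rw [g7, show S.Live y ↔ _ from live_iff_path (p := (x, y)), ← not_sat_iff_unbounded, not_not]

end Main

end RAM

namespace RAM

/-! ### The complete decision procedure -/

section Decide

open LSTS

/-- The program that decides strong detectability. -/
def decideProg : Program :=
  .seq (.assign 1 (.cell 0 (.lit 0))) <| .seq (.assign 2 (.cell 0 (.lit 1))) <|
  .seq (.assign 3 (.times (.reg 1) (.reg 1))) <|
  .cond (.times (.reg 1) (.reg 2))
    (.seq analyze (.seq (Term.answer.comp 0 0) (.assign 0 (.reg (tmpReg 0)))))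
    (.assign 0 (.lit 1))

variable {X T Y : Type*} [Fintype X] [Fintype T] {S : LSTS X T Y}
  {eX : X ≃ Fin (Fintype.card X)} {eT : T ≃ Fin (Fintype.card T)}

/-- Without states or without events there is no infinite run. The case is separate because the
absorption of lower monomials in the time bound needs positive sizes. -/
theorem stronglyDetectable_of_isEmpty (h : Fintype.card X * Fintype.card T = 0) :
    S.StronglyDetectable := by
  refine ⟨1, one_pos, fun _ ⟨τ, ⟨p, _⟩, _⟩ => ?_⟩
  rcases Nat.mul_eq_zero.1 h with h | h
  · exact (Fintype.card_eq_zero_iff.1 h).elim (p 0)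
  · exact (Fintype.card_eq_zero_iff.1 h).elim (τ 0)

theorem exec_decideProg {W K : ℕ} {inp : List ℕ} (hWK : WordSize X T W K)
    (hI : IsInput S eX eT fun i => inp.getD i 0) (h0 : inp.getD 0 0 = Fintype.card X)
    (h1 : inp.getD 1 0 = Fintype.card T) (hinp : ∀ i, inp.getD i 0 < K) :
    ∃ n s, Exec W decideProg (Store.ofInput inp) n s ∧
      n ≤ 100000 * (Fintype.card X ^ 4 * Fintype.card T ^ 2 + 1) ∧
      (s.reg 0 ≠ 0 ↔ S.StronglyDetectable) := by
  have hK := hWK.two_le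
  have hKW : K ^ 2 ≤ W := le_trans (Nat.pow_le_pow_right (by omega) (by omega)) hWK.pow_le
  have hKW' : K ≤ W := le_trans (Nat.le_self_pow (by omega) K) hKW
  have hsX : Fintype.card X < K := hWK.sizes_lt 0
  have hsT : Fintype.card T < K := hWK.sizes_lt 1
  have hsN : Fintype.card X * Fintype.card X < K := hWK.sizes_lt 2
  have hXT : Fintype.card X * Fintype.card T < W := by
    refine lt_of_lt_of_le ?_ hKW
    rw [pow_two]
    exact Nat.mul_lt_mul'' hsX hsT
  let s₀ := Store.ofInput inp
  let s₁ := s₀.setReg 1 (Fintype.card X)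
  let s₂ := s₁.setReg 2 (Fintype.card T)
  let s₃ := s₂.setReg 3 (Fintype.card X * Fintype.card X)
  have e1 : Exec W (.assign 1 (.cell 0 (.lit 0))) s₀
      ((Expr.cell 0 (.lit 0)).cost + 1) s₁ := by
    have := Exec.assign (W := W) (r := 1) (e := .cell 0 (.lit 0)) (s := s₀)
      ⟨by simp [Expr.Fits]; omega, (hinp 0).trans_le hKW'⟩
    rwa [show (Expr.cell 0 (.lit 0)).eval s₀ = Fintype.card X from h0] at this
  have e2 : Exec W (.assign 2 (.cell 0 (.lit 1))) s₁
      ((Expr.cell 0 (.lit 1)).cost + 1) s₂ := by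
    have := Exec.assign (W := W) (r := 2) (e := .cell 0 (.lit 1)) (s := s₁)
      ⟨by simp [Expr.Fits]; omega, (hinp 1).trans_le hKW'⟩
    rwa [show (Expr.cell 0 (.lit 1)).eval s₁ = Fintype.card T from h1] at this
  have e3 : Exec W (.assign 3 (.times (.reg 1) (.reg 1))) s₂
      ((Expr.times (.reg 1) (.reg 1)).cost + 1) s₃ :=
    Exec.assign (W := W) (r := 3) (e := .times (.reg 1) (.reg 1)) (s := s₂)
      ⟨hsX.trans_le hKW', hsX.trans_le hKW', hsN.trans_le hKW'⟩
  have hfit : (Expr.times (.reg 1) (.reg 2)).Fits W s₃ :=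
    ⟨hsX.trans_le hKW', hsT.trans_le hKW', hXT⟩
  have hval : (Expr.times (.reg 1) (.reg 2)).eval s₃ = Fintype.card X * Fintype.card T := rfl
  set M := Fintype.card X ^ 4 * Fintype.card T ^ 2 with hM
  rcases Nat.eq_zero_or_pos (Fintype.card X * Fintype.card T) with hz | hpos
  · refine ⟨_, _, .seq e1 (.seq e2 (.seq e3 (.condFalse hfit (hval.trans hz) (.assign ?_)))), ?_, ?_⟩
    · simp [Expr.Fits]; omega
    · simp only [Expr.cost]; omega
    · simp only [Expr.eval, Store.setReg_reg_self]
      exact iff_of_true one_ne_zero (stronglyDetectable_of_isEmpty hz)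
  · have hX : 0 < Fintype.card X := Nat.pos_of_mul_pos_right hpos
    have hT : 0 < Fintype.card T := Nat.pos_of_mul_pos_left hpos
    have hagree : Agree 0 (sizes X T) (fun _ => 0) s₃ := by
      refine ⟨fun i => ?_, fun m hm => absurd hm (Nat.not_lt_zero m)⟩
      fin_cases i <;> rfl
    have hA : ∀ a i, s₃.arr a i < K := fun a i => by
      change (if a = 0 then inp.getD i 0 else 0) < K
      split_ifs
      · exact hinp i
      · omega
    obtain ⟨n, s₄, e4, hn, hag, hb, h8, h3⟩ := does_analyze (S := S) hWK hI hA hX hT s₃ hagree rfl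
    obtain ⟨n', s₅, e5, hn', -, -, hr⟩ := exec_comp hK hWK.sizes_lt Term.answer 0 0 (fun _ => 0) s₄
      (by decide) (fun m hm => absurd hm (Nat.not_lt_zero m)) hag hb
      (le_trans (Nat.pow_le_pow_right (by omega) (by decide)) hWK.pow_le)
    have hans := (tab_cost_le (sz := sizes X T) hX hT).2.2
    rw [sizes_zero, sizes_one, ← hM] at hans
    rw [val_answer (A := s₄.arr) h8 h3] at hr
    refine ⟨_, _, .seq e1 (.seq e2 (.seq e3 (.condTrue hfit (by rw [hval]; omega)
      (.seq e4 (.seq e5 (.assign ?_)))))), ?_, ?_⟩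
    · rw [Expr.Fits, hr]
      exact ((ind_le_one _).trans_lt hK).trans_le hKW'
    · simp only [Expr.cost]; omega
    · rw [Store.setReg_reg_self, Expr.eval, hr, ← pos_iff_ne_zero, ind_pos, ← not_iff_not,
        not_stronglyDetectable_iff, ambiguous_iff_path]
      simp only [not_not]

end Decide

/-! ### The input -/

section Input

variable {X T Y : Type*} [Fintype X] [Fintype T] [Fintype Y] (S : LSTS X T Y)
  (eX : X ≃ Fin (Fintype.card X)) (eT : T ≃ Fin (Fintype.card T)) (eY : Y ≃ Fin (Fintype.card Y))

theorem getD_ofFn {n : ℕ} (f : Fin n → ℕ) (i : Fin n) : (List.ofFn f).getD i 0 = f i := by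
  rw [List.getD_eq_getElem _ _ (by simp), List.getElem_ofFn]

theorem getD_append_add (l l' : List ℕ) (i : ℕ) : (l ++ l').getD (l.length + i) 0 = l'.getD i 0 := by
  rw [List.getD_append_right _ _ _ _ (Nat.le_add_right _ _), Nat.add_sub_cancel_left]

theorem getD_lt {l : List ℕ} {K : ℕ} (hK : 0 < K) (h : ∀ x ∈ l, x < K) (i : ℕ) :
    l.getD i 0 < K := by
  rcases lt_or_ge i l.length with hi | hi
  · rw [List.getD_eq_getElem _ _ hi]
    exact h _ (List.getElem_mem hi)
  · rwa [List.getD_eq_default _ _ hi]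

theorem encode_label (t : T) : (S.encode eX eT eY).getD (3 + eT t) 0 =
    match S.label t with
    | none => 0
    | some y => (eY y : ℕ) + 1 := by
  rw [LSTS.encode, List.append_assoc, List.append_assoc]
  refine (getD_append_add [_, _, _] _ _).trans ?_
  rw [List.getD_append _ _ _ _ (by simp), getD_ofFn, Equiv.symm_apply_apply]

theorem encode_init (x : X) : (S.encode eX eT eY).getD (3 + Fintype.card T + eX x) 0 =
    ind (x ∈ S.init) := by
  rw [LSTS.encode, List.append_assoc, List.getD_append_right _ _ _ _ (by simp; omega)]
  have : ∀ m : ℕ, 3 + Fintype.card T + m - (3 + Fintype.card T) = m := by omega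
  simp only [List.length_append, List.length_cons, List.length_nil, List.length_ofFn, zero_add,
    Nat.reduceAdd, this]
  rw [List.getD_append _ _ _ _ (by simp), getD_ofFn, Equiv.symm_apply_apply]
  rfl

theorem encode_trans (x : X) (t : T) (y : X) :
    (S.encode eX eT eY).getD (3 + Fintype.card T + Fintype.card X +
      (Fintype.card X * (Fintype.card T * eX x + eT t) + eX y)) 0 = ind (S.trans x t y) := by
  rw [LSTS.encode, List.getD_append_right _ _ _ _ (by simp; omega)]
  have : ∀ m : ℕ, 3 + Fintype.card T + Fintype.card X + m - (3 + Fintype.card T + Fintype.card X) =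
    m := by omega
  simp only [List.length_append, List.length_cons, List.length_nil, List.length_ofFn, zero_add,
    Nat.reduceAdd, this]
  have h : Fintype.card X * (Fintype.card T * eX x + eT t) + eX y =
      (finProdFinEquiv (finProdFinEquiv (eX x, eT t), eX y) : ℕ) := by
    simp [finProdFinEquiv]
    ring
  rw [h, getD_ofFn]
  refine ind_congr ?_
  erw [Equiv.symm_apply_apply]
  dsimp only
  erw [Equiv.symm_apply_apply]
  simp

theorem isInput_encode : IsInput S eX eT fun i => (S.encode eX eT eY).getD i 0 where
  unobservable t := by
    rw [encode_label]
    cases S.label t <;> simp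
  label_eq t t' := by
    rw [encode_label, encode_label]
    cases S.label t <;> cases S.label t' <;> simp [coe_inj_iff]
  init := encode_init S eX eT eY
  trans := encode_trans S eX eT eY

theorem encode_lt {K : ℕ} (hK : Fintype.card X + Fintype.card T + Fintype.card Y + 2 ≤ K) (i : ℕ) :
    (S.encode eX eT eY).getD i 0 < K := by
  refine getD_lt (by omega) (fun m hm => ?_) i
  simp only [LSTS.encode, List.mem_append, List.mem_cons, List.not_mem_nil, or_false,
    List.mem_ofFn] at hm
  rcases hm with ((hm | ⟨t, rfl⟩) | ⟨x, rfl⟩) | ⟨j, rfl⟩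
  · omega
  · split
    · omega
    · rename_i y _
      exact (Nat.succ_lt_succ (eY y).2).trans_le (by omega)
  · split_ifs <;> omega
  · split_ifs <;> omega

end Input

theorem exists_program_decides_stronglyDetectable :
    ∃ (P : Program) (c : ℕ), ∀ (X T Y : Type*) [Fintype X] [Fintype T] [Fintype Y]
      (S : LSTS X T Y) (eX : X ≃ Fin (Fintype.card X)) (eT : T ≃ Fin (Fintype.card T))
      (eY : Y ≃ Fin (Fintype.card Y)), ∃ (n : ℕ) (s : Store),
        Exec ((Fintype.card X + Fintype.card T + Fintype.card Y + 2) ^ c) P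
          (Store.ofInput (S.encode eX eT eY)) n s ∧
        n ≤ c * (Fintype.card X ^ 4 * Fintype.card T ^ 2 + 1) ∧
        (s.reg 0 ≠ 0 ↔ S.StronglyDetectable) := by
  -- One constant serves as time factor and as word-size exponent; it is kept opaque so that the
  -- power is not unfolded.
  obtain ⟨c, hc⟩ : ∃ c, c = 100000 := ⟨_, rfl⟩
  refine ⟨decideProg, c, fun X T Y _ _ _ S eX eT eY => ?_⟩
  -- The data bound is a square because `|X| * |X|` is one of the sizes. The exponent `50` in
  -- `WordSize` covers the widths of all terms used, so an exponent of `100` would suffice here.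
  have hWK : WordSize X T ((Fintype.card X + Fintype.card T + Fintype.card Y + 2) ^ c)
      ((Fintype.card X + Fintype.card T + Fintype.card Y + 2) ^ 2) := by
    set B := Fintype.card X + Fintype.card T + Fintype.card Y + 2 with hB
    have hBB : B ≤ B ^ 2 := Nat.le_self_pow two_ne_zero _
    refine ⟨by omega, fun i => ?_, ?_⟩
    · fin_cases i
      · change Fintype.card X < _
        omega
      · change Fintype.card T < _
        omega
      · change Fintype.card X * Fintype.card X < _
        rw [pow_two]
        exact Nat.mul_lt_mul'' (by omega) (by omega)
    · rw [← pow_mul]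
      exact Nat.pow_le_pow_right (by omega) (by omega)
  have := exec_decideProg hWK (isInput_encode S eX eT eY) rfl rfl
    (encode_lt S eX eT eY (Nat.le_self_pow two_ne_zero _))
  rwa [← hc] at this

end RAM

theorem theorem7 :
    -- the cycle characterization, and its verification by strongly connected components
    (∀ (X T Y : Type*) [Finite X] [Finite T] [Finite Y] (S : LSTS X T Y),
      (¬ S.StronglyDetectable ↔ S.CycleCriterion) ∧
      (¬ S.StronglyDetectable ↔ S.restarted.acc.omegaLanguage.Nonempty) ∧
      (¬ S.StronglyDetectable ↔ ∃ x, S.restarted.acc.obsAut.HasObsSCC x)) ∧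
    -- one program decides strong detectability of all finite automata, within the time bound,
    -- with machine words of `O(log (|X| + |T| + |Y|))` bits
    ∃ (P : RAM.Program) (c : ℕ),
      ∀ (X T Y : Type*) [Fintype X] [Fintype T] [Fintype Y] (S : LSTS X T Y)
        (eX : X ≃ Fin (Fintype.card X)) (eT : T ≃ Fin (Fintype.card T))
        (eY : Y ≃ Fin (Fintype.card Y)),
        ∃ (n : ℕ) (s : RAM.Store),
          RAM.Exec ((Fintype.card X + Fintype.card T + Fintype.card Y + 2) ^ c) P
            (RAM.Store.ofInput (S.encode eX eT eY)) n s ∧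
          n ≤ c * (Fintype.card X ^ 4 * Fintype.card T ^ 2 + 1) ∧
          (s.reg 0 ≠ 0 ↔ S.StronglyDetectable) :=
  ⟨fun _ _ _ _ _ _ S => S.not_stronglyDetectable_characterizations,
    RAM.exists_program_decides_stronglyDetectable⟩
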